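/- \textbf{Setting.} Let $\Omega\subset\mathbb R^2$ be bounded, with $\overline\Omega$ the union of a finite conforming fine mesh $\mathcal T^h$ of axis-parallel closed rectangles (disjoint interiors; two rectangles that meet do so in a common vertex or a common edge), and let $h$ be the maximal side length. Assume every side has length at least $h/\sigma$, where $\sigma\ge1$. Let $\mathcal T^H$ be a coarse mesh whose blocks $K$ are unions of fine rectangles, and let $\mathcal E^H$ be the set of its edges. On an interior coarse edge $e$ shared by $K^+$ and $K^-$, with unit normal $n$ pointing from $K^+$ to $K^-$, put $\{v\}_e=\frac12(v^++v^-)$ and $[v]_e=v^+-v^-$; on $e\subset\partial\Omega$ put $\{v\}_e=[v]_e=v$, with $n$ the outward normal. Let $a$ be measurable with $0<a_0\le a\le a_1$ on each closed block (edges included). It may jump across coarse edges; then in $\{a\nabla u\cdot n\}_e$ each side uses its own trace of $a$, and in the terms $\int_e a[u]_e[v]_e$ and $\|a^{1/2}[u]_e\|^2_{L^2(e)}$ the average of the two traces is used. For $u,v$ piecewise bilinear on the fine mesh and, on each block $K$, continuous, set $$a(u,v)=\sum_{K\in\mathcal T^H}\int_K a\nabla u\cdot\nabla v,$$ $$a_{DG}(u,v)=a(u,v)+\sum_{e\in\mathcal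 E^H}\Big(-\int_e\{a\nabla u\cdot n\}_e[v]_e-\int_e\{a\nabla v\cdot n\}_e[u]_e+\frac\gamma h\int_e a[u]_e[v]_e\Big),$$ $$\|u\|_a^2=a(u,u)+\frac\gamma h\sum_{e}\|a^{1/2}[u]_e\|_{L^2(e)}^2,\qquad \|u\|_{H^1(\mathcal T^H)}^2=\sum_K|u|_{H^1(K)}^2+\frac\gamma h\sum_{e}\|[u]_e\|_{L^2(e)}^2 .$$ Let $V_h$ be the space of continuous functions on $\overline\Omega$ that are piecewise bilinear on $\mathcal T^h$ and vanish on $\partial\Omega$. Let $V_H$ be any linear subspace of the space of functions that are, on each coarse block, continuous and piecewise bilinear on the fine mesh, with no continuity across coarse edges (for example the space spanned by the local multiscale basis functions of the generalized multiscale finite element method). Let $T>0$ and $f(t,\cdot)\in L^2(\Omega)$ for $t\in[0,T]$, and let $(\cdot,\cdot)$ be the $L^2(\Omega)$ inner product. Let $u_h(t)\in V_h$ and $u_H(t)\in V_H$ be twice differentiable in $t$ and satisfy, for all $t\in[0,T]$, $$((u_h)_{tt},v)+a(u_h,v)=(f,v)\ \ \forall v\in V_h,\qquad ((u_H)_{tt},v)+a_{DG}(u_H,v)=(f,v)\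 \ \forall v\in V_H,$$ and let $w_H(t)\in V_H$ be such that, for all $t\in[0,T]$, $$a_{DG}(w_H,v)=a_{DG}(u_h,v)+R_{u_h}(v)\ \ \forall v\in V_H,\qquad R_{u_h}(v)=(f,v)-((u_h)_{tt},v)-a_{DG}(u_h,v).$$ Suppose that $w_H$ is twice differentiable in $t$, put $\eta=u_h-w_H$, $\xi=u_H-w_H$, $\varepsilon=u_h-u_H$, and suppose that $t\mapsto\|\eta_{tt}(t)\|_{L^2(\Omega)}$ is integrable on $[0,T]$. \textbf{Theorem.} There is a constant $C>0$ depending only on $a_0,a_1$, and for each $\sigma\ge 1$ a constant $\gamma_0>0$ depending only on $a_0,a_1,\sigma$, such that in the setting above, whenever $\gamma\ge\gamma_0$, $$\|\varepsilon_t\|_{L^\infty([0,T];L^2(\Omega))}+\|\varepsilon\|_{L^\infty([0,T];a)}\le C\Big(\|\eta_t\|_{L^\infty([0,T];L^2(\Omega))}+\|\eta\|_{L^\infty([0,T];H^1(\mathcal T^H))}+\|\eta_{tt}\|_{L^1([0,T];L^2(\Omega))}+\|\xi_t(0)\|_{L^2(\Omega)}+\|\xi(0)\|_{H^1(\mathcal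 T^H)}\Big),$$ where $\|v\|_{L^\infty([0,T];X)}=\max_{0\le t\le T}\|v(t)\|_X$ and $\|v\|_{L^1([0,T];X)}=\int_0^T\|v(t)\|_X\,dt$. -/

import Mathlib

open MeasureTheory Set
open scoped BigOperators

noncomputable section

namespace WaveDG

/-- The four sides of an axis-parallel rectangle. -/
inductive Side where
  | left
  | right
  | bottom
  | top

instance : Fintype Side where
  elems := ⟨([.left, .right, .bottom, .top] : List Side), by simp⟩
  complete := fun s => by cases s <;> simp

/-- Outward unit normal of a rectangle on each of its sides. -/
def Side.normal : Side → ℝ × ℝ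
  | .left => (-1, 0)
  | .right => (1, 0)
  | .bottom => (0, -1)
  | .top => (0, 1)

/-- The bilinear polynomial `c₀ + c₁ x + c₂ y + c₃ x y`. -/
def ev (c : Fin 4 → ℝ) (p : ℝ × ℝ) : ℝ :=
  c 0 + c 1 * p.1 + c 2 * p.2 + c 3 * (p.1 * p.2)

/-- The gradient of the bilinear polynomial `ev c`. -/
def grad (c : Fin 4 → ℝ) (p : ℝ × ℝ) : ℝ × ℝ :=
  (c 1 + c 3 * p.2, c 2 + c 3 * p.1)

theorem hasDerivAt_ev_fst (c : Fin 4 → ℝ) (p : ℝ × ℝ) :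
    HasDerivAt (fun x => ev c (x, p.2)) (grad c p).1 p.1 := by
  have h := ((((hasDerivAt_id p.1).const_mul (c 1)).const_add (c 0)).add_const
    (c 2 * p.2)).add (((hasDerivAt_id p.1).mul_const p.2).const_mul (c 3))
  simpa [ev, grad] using! h

theorem hasDerivAt_ev_snd (c : Fin 4 → ℝ) (p : ℝ × ℝ) :
    HasDerivAt (fun y => ev c (p.1, y)) (grad c p).2 p.2 := by
  have h := (((hasDerivAt_id p.2).const_mul (c 2)).const_add (c 0 + c 1 * p.1)).add
    (((hasDerivAt_id p.2).const_mul p.1).const_mul (c 3))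
  simpa [ev, grad] using! h

/-- The Euclidean dot product of the plane. -/
def dot (p q : ℝ × ℝ) : ℝ := p.1 * q.1 + p.2 * q.2

/-- Functions that are a bilinear polynomial on each fine cell, with no continuity across cells,
given by their coefficients on each cell. This is a finite dimensional space; every finite element
function below lives in it. -/
abbrev PW (ι : Type) : Type := ι → Fin 4 → ℝ

/-- A fine mesh of closed axis-parallel rectangles `[x0 i, x1 i] × [y0 i, y1 i]` with disjoint
interiors, that is conforming (two cells that meet do so in a common vertex or a common edge),
together with a coarse mesh, each of whose blocks is a union of fine cells:
`blk i` is the coarse block of the fine cell `i`. -/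
structure Mesh (ι κ : Type) where
  x0 : ι → ℝ
  x1 : ι → ℝ
  y0 : ι → ℝ
  y1 : ι → ℝ
  hx : ∀ i, x0 i < x1 i
  hy : ∀ i, y0 i < y1 i
  blk : ι → κ
  disjoint_interiors : ∀ i j, i ≠ j →
    Disjoint (Ioo (x0 i) (x1 i) ×ˢ Ioo (y0 i) (y1 i)) (Ioo (x0 j) (x1 j) ×ˢ Ioo (y0 j) (y1 j))
  conforming : ∀ i j,
    ((Icc (x0 i) (x1 i) ×ˢ Icc (y0 i) (y1 i)) ∩
      (Icc (x0 j) (x1 j) ×ˢ Icc (y0 j) (y1 j))).Nonempty →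
    (x1 i = x0 j ∨ x1 j = x0 i ∨ (x0 i = x0 j ∧ x1 i = x1 j)) ∧
    (y1 i = y0 j ∨ y1 j = y0 i ∨ (y0 i = y0 j ∧ y1 i = y1 j))

namespace Mesh

variable {ι κ : Type} (M : Mesh ι κ)

/-- The closed fine cell `i`. -/
def cell (i : ι) : Set (ℝ × ℝ) := Icc (M.x0 i) (M.x1 i) ×ˢ Icc (M.y0 i) (M.y1 i)

/-- The closure of the computational domain `Ω`. -/
def closedDomain : Set (ℝ × ℝ) := ⋃ i, M.cell i

/-- The fine mesh size: the maximum of all side lengths. -/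
def h : ℝ := ⨆ i, max (M.x1 i - M.x0 i) (M.y1 i - M.y0 i)

/-- Quasi-uniformity of the fine mesh: every side is at least `h / σ` long. -/
def QuasiUniform (σ : ℝ) : Prop :=
  ∀ i, M.h ≤ σ * min (M.x1 i - M.x0 i) (M.y1 i - M.y0 i)

/-- The cell `j` lies across the side `s` of the cell `i` and has that edge in common with it. -/
def Neighbor (i : ι) : Side → ι → Prop
  | .left, j => M.x1 j = M.x0 i ∧ M.y0 j = M.y0 i ∧ M.y1 j = M.y1 i
  | .right, j => M.x0 j = M.x1 i ∧ M.y0 j = M.y0 i ∧ M.y1 j = M.y1 i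
  | .bottom, j => M.y1 j = M.y0 i ∧ M.x0 j = M.x0 i ∧ M.x1 j = M.x1 i
  | .top, j => M.y0 j = M.y1 i ∧ M.x0 j = M.x0 i ∧ M.x1 j = M.x1 i

/-- Line integral over the side `s` of the cell `i`. -/
def sideIntegral (i : ι) (s : Side) (g : ℝ × ℝ → ℝ) : ℝ :=
  match s with
  | .left => ∫ y in (M.y0 i)..(M.y1 i), g (M.x0 i, y)
  | .right => ∫ y in (M.y0 i)..(M.y1 i), g (M.x1 i, y)
  | .bottom => ∫ x in (M.x0 i)..(M.x1 i), g (x, M.y0 i)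
  | .top => ∫ x in (M.x0 i)..(M.x1 i), g (x, M.y1 i)

/-- The pieces of coarse edges. The triple `(i, s, some j)` is the side `s` of the fine cell `i`
(in `K⁺`) across which lies the fine cell `j` (in `K⁻`), in another coarse block; the normal points
from `K⁺` to `K⁻`, and only right and top sides are taken, so that each piece occurs once. The
triple `(i, s, none)` is a piece of the boundary of the domain, with the outward normal. The coarse
edges are the unions of these pieces, and integrals over coarse edges add up from them. -/
def IsCoarseEdge (i : ι) (s : Side) : Option ι → Prop
  | none => ∀ j, ¬ M.Neighbor i s j
  | some j => (s = .right ∨ s = .top) ∧ M.Neighbor i s j ∧ M.blk i ≠ M.blk j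

/-- The jump `q⁺ - q⁻` of a quantity with the value `q i` seen from the cell `i`
(just `q⁺` on the boundary). -/
def jump (q : ι → ℝ) (i : ι) : Option ι → ℝ
  | none => q i
  | some j => q i - q j

/-- The average `(q⁺ + q⁻) / 2` (just `q⁺` on the boundary). -/
def avg (q : ι → ℝ) (i : ι) : Option ι → ℝ
  | none => q i
  | some j => (q i + q j) / 2

/-- The broken fine space: functions whose restriction to each coarse block is continuous and
piecewise bilinear for the fine mesh, with no condition across coarse edges. The coarse spaces
`V_H` are linear subspaces of it, in particular the ones spanned by discrete `a`-harmonic functions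
and interior eigenfunctions on the coarse blocks. -/
def brokenSpace : Submodule ℝ (PW ι) where
  carrier := {v | ∀ i j, M.blk i = M.blk j → ∀ p ∈ M.cell i ∩ M.cell j, ev (v i) p = ev (v j) p}
  zero_mem' := fun i j _ p _ => by simp [ev]
  add_mem' := fun {u v} hu hv i j hij p hp => by
    have h1 := hu i j hij p hp
    have h2 := hv i j hij p hp
    simp only [ev, Pi.add_apply] at *
    linarith
  smul_mem' := fun c u hu i j hij p hp => by
    have h1 := hu i j hij p hp
    simp only [ev, Pi.smul_apply, smul_eq_mul] at *
    linear_combination c * h1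

/-- The conforming space `V_h`: continuous, piecewise bilinear, zero on the boundary. -/
def Vh : Submodule ℝ (PW ι) where
  carrier := {v | (∀ i j, ∀ p ∈ M.cell i ∩ M.cell j, ev (v i) p = ev (v j) p) ∧
    ∀ i, ∀ p ∈ M.cell i ∩ frontier M.closedDomain, ev (v i) p = 0}
  zero_mem' := ⟨fun i j p _ => by simp [ev], fun i p _ => by simp [ev]⟩
  add_mem' := fun {u v} hu hv => by
    refine ⟨fun i j p hp => ?_, fun i p hp => ?_⟩
    · have h1 := hu.1 i j p hp
      have h2 := hv.1 i j p hp
      simp only [ev, Pi.add_apply] at *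
      linarith
    · have h1 := hu.2 i p hp
      have h2 := hv.2 i p hp
      simp only [ev, Pi.add_apply] at *
      linarith
  smul_mem' := fun c u hu => by
    refine ⟨fun i j p hp => ?_, fun i p hp => ?_⟩
    · have h1 := hu.1 i j p hp
      simp only [ev, Pi.smul_apply, smul_eq_mul] at *
      linear_combination c * h1
    · have h1 := hu.2 i p hp
      simp only [ev, Pi.smul_apply, smul_eq_mul] at *
      linear_combination c * h1

variable [Fintype ι]

open Classical in
/-- The sum over all coarse edges `e` of `∫_e g`; the integrand `g` may depend on the cells on the
two sides and on the side. -/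
def skeletonSum (g : ι → Side → Option ι → ℝ × ℝ → ℝ) : ℝ :=
  ∑ i, ∑ s : Side, ∑ m : Option ι,
    if M.IsCoarseEdge i s m then M.sideIntegral i s (g i s m) else 0

/-- The `L²(Ω)` inner product. -/
def l2 (u v : PW ι) : ℝ := ∑ i, ∫ p in M.cell i, ev (u i) p * ev (v i) p

/-- The linear functional `v ↦ (g, v)`. -/
def load (g : ℝ × ℝ → ℝ) (v : PW ι) : ℝ := ∑ i, ∫ p in M.cell i, g p * ev (v i) p

/-- The bilinear form `a(u, v) = ∑_K ∫_K a ∇u · ∇v`; here `a k` is the coefficient on the closed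
coarse block `k`. -/
def energy (a : κ → ℝ × ℝ → ℝ) (u v : PW ι) : ℝ :=
  ∑ i, ∫ p in M.cell i, a (M.blk i) p * dot (grad (u i) p) (grad (v i) p)

/-- The average `{a ∇u · n}` on an edge piece. -/
def avgFlux (a : κ → ℝ × ℝ → ℝ) (u : PW ι) (i : ι) (s : Side) (m : Option ι) (p : ℝ × ℝ) : ℝ :=
  avg (fun j => a (M.blk j) p * dot (grad (u j) p) s.normal) i m

/-- The jump `[u]` on an edge piece. -/
def jumpFn (u : PW ι) (i : ι) (m : Option ι) (p : ℝ × ℝ) : ℝ :=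
  jump (fun j => ev (u j) p) i m

/-- The value of the coefficient on an edge piece: the average of its two traces, which is the
coefficient itself when the two traces agree. -/
def avgCoeff (a : κ → ℝ × ℝ → ℝ) (i : ι) (m : Option ι) (p : ℝ × ℝ) : ℝ :=
  avg (fun j => a (M.blk j) p) i m

/-- The symmetric interior penalty form `a_DG`. -/
def aDG (a : κ → ℝ × ℝ → ℝ) (γ : ℝ) (u v : PW ι) : ℝ :=
  M.energy a u v
    - M.skeletonSum (fun i s m p => M.avgFlux a u i s m p * jumpFn v i m p)
    - M.skeletonSum (fun i s m p => M.avgFlux a v i s m p * jumpFn u i m p)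
    + γ / M.h *
      M.skeletonSum (fun i _ m p => M.avgCoeff a i m p * (jumpFn u i m p * jumpFn v i m p))

/-- The `L²(Ω)` norm. -/
def l2Norm (u : PW ι) : ℝ := Real.sqrt (M.l2 u u)

/-- The `a`-norm. -/
def aNorm (a : κ → ℝ × ℝ → ℝ) (γ : ℝ) (u : PW ι) : ℝ :=
  Real.sqrt (M.energy a u u
    + γ / M.h * M.skeletonSum (fun i _ m p => M.avgCoeff a i m p * jumpFn u i m p ^ 2))

/-- The broken `H¹` norm. -/
def h1Norm (γ : ℝ) (u : PW ι) : ℝ :=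
  Real.sqrt ((∑ i, ∫ p in M.cell i, dot (grad (u i) p) (grad (u i) p))
    + γ / M.h * M.skeletonSum (fun i _ m p => jumpFn u i m p ^ 2))

end Mesh

/-- The time derivative on `[0, T]` (one-sided at the end points). -/
def dt {ι : Type} [Fintype ι] (T : ℝ) (u : ℝ → PW ι) : ℝ → PW ι :=
  derivWithin u (Icc 0 T)

/-- `u` is twice differentiable in time on `[0, T]`. -/
def TwiceDiff {ι : Type} [Fintype ι] (T : ℝ) (u : ℝ → PW ι) : Prop :=
  DifferentiableOn ℝ u (Icc 0 T) ∧ DifferentiableOn ℝ (dt T u) (Icc 0 T)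

/-- The maximum over `[0, T]`. -/
def timeMax (T : ℝ) (g : ℝ → ℝ) : ℝ := sSup (g '' Icc 0 T)

theorem isGreatest_timeMax {T : ℝ} (hT : 0 ≤ T) {g : ℝ → ℝ} (hg : ContinuousOn g (Icc 0 T)) :
    IsGreatest (g '' Icc 0 T) (timeMax T g) :=
  (isCompact_Icc.image_of_continuousOn hg).isGreatest_sSup ((nonempty_Icc.2 hT).image g)

namespace Mesh

variable {ι κ : Type} [Fintype ι] (M : Mesh ι κ)

/-- `uh` is a fine scale solution: for every time it lies in `V_h`, and
`((u_h)_tt, v) + a(u_h, v) = (f, v)` for all `v ∈ V_h`. -/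
def IsFineSolution (a : κ → ℝ × ℝ → ℝ) (f : ℝ → ℝ × ℝ → ℝ) (T : ℝ) (uh : ℝ → PW ι) : Prop :=
  TwiceDiff T uh ∧ ∀ t ∈ Icc 0 T, uh t ∈ M.Vh ∧
    ∀ v ∈ M.Vh, M.l2 (dt T (dt T uh) t) v + M.energy a (uh t) v = M.load (f t) v

/-- `uH` is a semi-discrete coarse solution: for every time it lies in `V_H`, and
`((u_H)_tt, v) + a_DG(u_H, v) = (f, v)` for all `v ∈ V_H`. -/
def IsCoarseSolution (a : κ → ℝ × ℝ → ℝ) (γ : ℝ) (f : ℝ → ℝ × ℝ → ℝ) (T : ℝ)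
    (VH : Submodule ℝ (PW ι)) (uH : ℝ → PW ι) : Prop :=
  TwiceDiff T uH ∧ ∀ t ∈ Icc 0 T, uH t ∈ VH ∧
    ∀ v ∈ VH, M.l2 (dt T (dt T uH) t) v + M.aDG a γ (uH t) v = M.load (f t) v

/-- The consistency error `R_{u_h}(v) = (f, v) - ((u_h)_tt, v) - a_DG(u_h, v)` at time `t`. -/
def residual (a : κ → ℝ × ℝ → ℝ) (γ : ℝ) (f : ℝ → ℝ × ℝ → ℝ) (T : ℝ) (uh : ℝ → PW ι) (t : ℝ)
    (v : PW ι) : ℝ :=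
  M.load (f t) v - M.l2 (dt T (dt T uh) t) v - M.aDG a γ (uh t) v

/-- `wH` is the elliptic projection of `uh`: for every time it lies in `V_H`, and
`a_DG(w_H, v) = a_DG(u_h, v) + R_{u_h}(v)` for all `v ∈ V_H`. -/
def IsEllipticProjection (a : κ → ℝ × ℝ → ℝ) (γ : ℝ) (f : ℝ → ℝ × ℝ → ℝ) (T : ℝ)
    (VH : Submodule ℝ (PW ι)) (uh wH : ℝ → PW ι) : Prop :=
  ∀ t ∈ Icc 0 T, wH t ∈ VH ∧
    ∀ v ∈ VH, M.aDG a γ (wH t) v = M.aDG a γ (uh t) v + M.residual a γ f T uh t v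

end Mesh

end WaveDG

end

noncomputable section

namespace WaveDG

/-! Write `ε = η - ξ`. The `η` part is bounded by the right-hand side, so only `ξ`, which lies in
`VH`, has to be estimated. The residual in the definition of `wH` cancels `a_DG(u_h, v)`, so
subtracting the projection equation from the coarse one leaves `(ξ_tt, v) + a_DG(ξ, v) = (η_tt, v)`
on `VH` (`error_equation`).

Testing with `v = ξ_t` shows that `W = ‖ξ_t‖² + a_DG(ξ, ξ)` satisfies `W' = 2 (η_tt, ξ_t) ≤ 2 ‖η_tt‖
√W`. Hence `√W` grows by at most the time integral of `‖η_tt‖` (`sqrt_energy_le`).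

This needs `a_DG` to be comparable with the squared `a`-norm (`aDG_self_mem`). The consistency term
is absorbed by Young's inequality and a discrete trace inequality. The latter is elementary here:
the normal derivative of a bilinear function on a rectangle is constant along the normal direction,
so its square integrates over the cell to the side integral times the width. Once `γ` exceeds a
threshold depending on `σ`, the comparison factors are absolute, which is why `C` depends neither on
`σ` nor on `γ`. -/

theorem integrable_bounded_mul_continuous {μ : Measure (ℝ × ℝ)} [IsFiniteMeasure μ]
    {K : Set (ℝ × ℝ)} (hK : IsCompact K) (hμ : ∀ᵐ p ∂μ, p ∈ K) {α P : ℝ × ℝ → ℝ}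
    (hα : Measurable α) {c : ℝ} (hb : ∀ p ∈ K, ‖α p‖ ≤ c) (hP : Continuous P) :
    Integrable (fun p => α p * P p) μ := by
  obtain ⟨c', hc'⟩ := hK.exists_bound_of_continuousOn hP.continuousOn
  have hPi : Integrable P μ := Integrable.of_bound hP.aestronglyMeasurable c'
    (hμ.mono fun p hp => hc' p hp)
  exact hPi.bdd_mul hα.aestronglyMeasurable (hμ.mono fun p hp => hb p hp)

@[fun_prop]
theorem continuous_ev (c : Fin 4 → ℝ) : Continuous (ev c) := by
  unfold ev; fun_prop

@[fun_prop]
theorem continuous_grad (c : Fin 4 → ℝ) : Continuous (grad c) := by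
  unfold grad; fun_prop

@[fun_prop]
theorem Continuous.dot {X : Type*} [TopologicalSpace X] {f g : X → ℝ × ℝ} (hf : Continuous f)
    (hg : Continuous g) : Continuous (fun x => dot (f x) (g x)) := by
  unfold WaveDG.dot; fun_prop

theorem ev_add (c d : Fin 4 → ℝ) (p : ℝ × ℝ) : ev (c + d) p = ev c p + ev d p := by
  simp only [ev, Pi.add_apply]; ring

theorem ev_smul (r : ℝ) (c : Fin 4 → ℝ) (p : ℝ × ℝ) : ev (r • c) p = r * ev c p := by
  simp only [ev, Pi.smul_apply, smul_eq_mul]; ring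

theorem dot_grad_add (c d : Fin 4 → ℝ) (p q : ℝ × ℝ) :
    dot (grad (c + d) p) q = dot (grad c p) q + dot (grad d p) q := by
  simp only [dot, grad, Pi.add_apply]; ring

theorem dot_grad_smul (r : ℝ) (c : Fin 4 → ℝ) (p q : ℝ × ℝ) :
    dot (grad (r • c) p) q = r * dot (grad c p) q := by
  simp only [dot, grad, Pi.smul_apply, smul_eq_mul]; ring

theorem dot_comm (p q : ℝ × ℝ) : dot p q = dot q p := by
  simp only [dot]; ring

theorem dot_self_nonneg (p : ℝ × ℝ) : 0 ≤ dot p p :=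
  add_nonneg (mul_self_nonneg _) (mul_self_nonneg _)

/-- The opposite side of a rectangle. -/
def Side.opp : Side → Side
  | .left => .right
  | .right => .left
  | .bottom => .top
  | .top => .bottom

theorem Side.opp_injective : Function.Injective Side.opp := by
  intro s t h
  cases s <;> cases t <;> simp_all [Side.opp]

theorem dot_opp_normal (q : ℝ × ℝ) (s : Side) : dot q s.opp.normal = -dot q s.normal := by
  cases s <;> simp [dot, Side.opp, Side.normal]

/-! ### Side measures, neighbouring cells and integrability on edges. -/

namespace Mesh

variable {ι κ : Type} (M : Mesh ι κ)

/-- Arc length on the side `s` of the cell `i`. -/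
def sideMeasure (i : ι) (s : Side) : Measure (ℝ × ℝ) :=
  match s with
  | .left => (volume.restrict (Ioc (M.y0 i) (M.y1 i))).map (fun y => (M.x0 i, y))
  | .right => (volume.restrict (Ioc (M.y0 i) (M.y1 i))).map (fun y => (M.x1 i, y))
  | .bottom => (volume.restrict (Ioc (M.x0 i) (M.x1 i))).map (fun x => (x, M.y0 i))
  | .top => (volume.restrict (Ioc (M.x0 i) (M.x1 i))).map (fun x => (x, M.y1 i))

instance (i : ι) (s : Side) : IsFiniteMeasure (M.sideMeasure i s) := by
  cases s <;> unfold sideMeasure <;> infer_instance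

/-- With a measure on the plane, linearity, monotonicity and almost-everywhere bounds no longer need
a case split over the four sides. -/
theorem sideIntegral_eq (i : ι) (s : Side) (g : ℝ × ℝ → ℝ) :
    M.sideIntegral i s g = ∫ p, g p ∂M.sideMeasure i s := by
  have hx := (M.hx i).le
  have hy := (M.hy i).le
  cases s <;> simp only [sideIntegral, sideMeasure]
  · rw [intervalIntegral.integral_of_le hy, (measurableEmbedding_prodMk_left _).integral_map]
  · rw [intervalIntegral.integral_of_le hy, (measurableEmbedding_prodMk_left _).integral_map]
  · rw [intervalIntegral.integral_of_le hx, (measurableEmbedding_prod_mk_right _).integral_map]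
  · rw [intervalIntegral.integral_of_le hx, (measurableEmbedding_prod_mk_right _).integral_map]

theorem measurableSet_cell (i : ι) : MeasurableSet (M.cell i) :=
  measurableSet_Icc.prod measurableSet_Icc

theorem isCompact_cell (i : ι) : IsCompact (M.cell i) := isCompact_Icc.prod isCompact_Icc

instance (i : ι) : IsFiniteMeasure (volume.restrict (M.cell i)) :=
  isFiniteMeasure_restrict.2 (M.isCompact_cell i).measure_lt_top.ne

theorem ae_sideMeasure_mem_cell (i : ι) (s : Side) : ∀ᵐ p ∂M.sideMeasure i s, p ∈ M.cell i := by
  have hx := (M.hx i).le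
  have hy := (M.hy i).le
  cases s <;> simp only [sideMeasure] <;>
  · refine (ae_map_iff (by fun_prop) (M.measurableSet_cell i)).2
      ((ae_restrict_mem measurableSet_Ioc).mono fun z hz => ?_)
    refine ⟨⟨?_, ?_⟩, ?_, ?_⟩ <;> linarith [hz.1, hz.2]

variable {M} in
theorem Neighbor.symm {i j : ι} {s : Side} (h : M.Neighbor i s j) : M.Neighbor j s.opp i := by
  cases s <;> exact ⟨h.1.symm, h.2.1.symm, h.2.2.symm⟩

variable {M} in
-- A common edge carries a single measure, so facts about the far cell transfer to integrals taken
-- from the near one.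
theorem Neighbor.sideMeasure_eq {i j : ι} {s : Side} (h : M.Neighbor i s j) :
    M.sideMeasure i s = M.sideMeasure j s.opp := by
  cases s <;> obtain ⟨h1, h2, h3⟩ := h <;> simp only [sideMeasure, Side.opp, h1, h2, h3]

theorem eq_of_mem_interior {i j : ι} {x y : ℝ} (hi : x ∈ Ioo (M.x0 i) (M.x1 i))
    (hi' : y ∈ Ioo (M.y0 i) (M.y1 i)) (hj : x ∈ Ioo (M.x0 j) (M.x1 j))
    (hj' : y ∈ Ioo (M.y0 j) (M.y1 j)) : i = j := by
  by_contra hne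
  exact Set.disjoint_left.1 (M.disjoint_interiors i j hne) (mk_mem_prod hi hi') (mk_mem_prod hj hj')

variable {M} in
-- Both cells contain in their interiors the points just beyond the edge, against disjointness. This
-- is what prevents double counting of edges.
theorem Neighbor.unique {i j k : ι} {s : Side} (hj : M.Neighbor i s j) (hk : M.Neighbor i s k) :
    j = k := by
  have hxj := M.hx j
  have hyj := M.hy j
  have hxk := M.hx k
  have hyk := M.hy k
  cases s <;> obtain ⟨h1, h2, h3⟩ := hj <;> obtain ⟨k1, k2, k3⟩ := hk
  · obtain ⟨x, hx, hx'⟩ := exists_between (max_lt (h1 ▸ hxj) (k1 ▸ hxk))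
    obtain ⟨y, hy, hy'⟩ := exists_between (M.hy i)
    rw [max_lt_iff] at hx
    refine M.eq_of_mem_interior (x := x) (y := y) ⟨?_, ?_⟩ ⟨?_, ?_⟩ ⟨?_, ?_⟩ ⟨?_, ?_⟩ <;>
      linarith [hx.1, hx.2]
  · obtain ⟨x, hx, hx'⟩ := exists_between (lt_min (h1 ▸ hxj) (k1 ▸ hxk))
    obtain ⟨y, hy, hy'⟩ := exists_between (M.hy i)
    rw [lt_min_iff] at hx'
    refine M.eq_of_mem_interior (x := x) (y := y) ⟨?_, ?_⟩ ⟨?_, ?_⟩ ⟨?_, ?_⟩ ⟨?_, ?_⟩ <;>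
      linarith [hx'.1, hx'.2]
  · obtain ⟨x, hx, hx'⟩ := exists_between (M.hx i)
    obtain ⟨y, hy, hy'⟩ := exists_between (max_lt (h1 ▸ hyj) (k1 ▸ hyk))
    rw [max_lt_iff] at hy
    refine M.eq_of_mem_interior (x := x) (y := y) ⟨?_, ?_⟩ ⟨?_, ?_⟩ ⟨?_, ?_⟩ ⟨?_, ?_⟩ <;>
      linarith [hy.1, hy.2]
  · obtain ⟨x, hx, hx'⟩ := exists_between (M.hx i)
    obtain ⟨y, hy, hy'⟩ := exists_between (lt_min (h1 ▸ hyj) (k1 ▸ hyk))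
    rw [lt_min_iff] at hy'
    refine M.eq_of_mem_interior (x := x) (y := y) ⟨?_, ?_⟩ ⟨?_, ?_⟩ ⟨?_, ?_⟩ ⟨?_, ?_⟩ <;>
      linarith [hy'.1, hy'.2]

/-- The coefficient `a` is measurable, with values in `[a₀, a₁]` on each closed block. -/
structure IsCoeff (a : κ → ℝ × ℝ → ℝ) (a₀ a₁ : ℝ) : Prop where
  measurable : ∀ k, Measurable (a k)
  lower : ∀ i, ∀ p ∈ M.cell i, a₀ ≤ a (M.blk i) p
  upper : ∀ i, ∀ p ∈ M.cell i, a (M.blk i) p ≤ a₁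

variable {M} {a : κ → ℝ × ℝ → ℝ} {a₀ a₁ : ℝ}

/-- The broken `H¹` norm is the `a`-norm of the coefficient 1, so every result for a general
coefficient serves both norms. -/
theorem isCoeff_one : M.IsCoeff (fun _ _ => 1) 1 1 :=
  ⟨fun _ => measurable_const, fun _ _ _ => le_rfl, fun _ _ _ => le_rfl⟩

theorem IsCoeff.norm_le (ha : M.IsCoeff a a₀ a₁) (h₀ : 0 ≤ a₀) (i : ι) :
    ∀ p ∈ M.cell i, ‖a (M.blk i) p‖ ≤ a₁ := fun p hp => by
  rw [Real.norm_of_nonneg (h₀.trans (ha.lower i p hp))]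
  exact ha.upper i p hp

theorem IsCoeff.integrableOn_mul (ha : M.IsCoeff a a₀ a₁) (h₀ : 0 ≤ a₀) (i : ι)
    {P : ℝ × ℝ → ℝ} (hP : Continuous P) :
    IntegrableOn (fun p => a (M.blk i) p * P p) (M.cell i) :=
  integrable_bounded_mul_continuous (M.isCompact_cell i)
    (ae_restrict_mem (M.measurableSet_cell i)) (ha.measurable _) (ha.norm_le h₀ i) hP

theorem IsCoeff.integrable_side_mul (ha : M.IsCoeff a a₀ a₁) (h₀ : 0 ≤ a₀) (i : ι) (s : Side)
    {P : ℝ × ℝ → ℝ} (hP : Continuous P) :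
    Integrable (fun p => a (M.blk i) p * P p) (M.sideMeasure i s) :=
  integrable_bounded_mul_continuous (M.isCompact_cell i)
    (M.ae_sideMeasure_mem_cell i s) (ha.measurable _) (ha.norm_le h₀ i) hP

theorem integrable_side_of_continuous (i : ι) (s : Side) {P : ℝ × ℝ → ℝ} (hP : Continuous P) :
    Integrable P (M.sideMeasure i s) := by
  simpa using isCoeff_one.integrable_side_mul zero_le_one i s hP

/-- Each trace is controlled only on its own closed cell, so the far half is integrated along the
opposite side of the neighbour and then transferred. -/
theorem IsCoeff.integrable_avg_mul (ha : M.IsCoeff a a₀ a₁) (h₀ : 0 ≤ a₀) {i : ι} {s : Side}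
    {m : Option ι} (he : M.IsCoarseEdge i s m) {F : ι → ℝ × ℝ → ℝ} (hF : ∀ j, Continuous (F j))
    {J : ℝ × ℝ → ℝ} (hJ : Continuous J) :
    Integrable (fun p => avg (fun j => a (M.blk j) p * F j p) i m * J p) (M.sideMeasure i s) := by
  cases m with
  | none =>
    refine (ha.integrable_side_mul h₀ i s ((hF i).mul hJ)).congr (.of_forall fun p => ?_)
    simp only [avg, Pi.mul_apply]; ring
  | some j =>
    have h1 := ha.integrable_side_mul h₀ i s (((hF i).mul hJ).div_const 2)
    have h2 := ha.integrable_side_mul h₀ j s.opp (((hF j).mul hJ).div_const 2)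
    rw [← he.2.1.sideMeasure_eq] at h2
    refine (h1.add h2).congr (.of_forall fun p => ?_)
    simp only [avg, Pi.mul_apply, Pi.add_apply]; ring

theorem IsCoarseEdge.ae_avg_of_forall {i : ι} {s : Side}
    {m : Option ι} (he : M.IsCoarseEdge i s m) {Q : ι → ℝ × ℝ → Prop}
    (hQ : ∀ j, ∀ p ∈ M.cell j, Q j p) :
    ∀ᵐ p ∂M.sideMeasure i s, Q i p ∧ ∀ j ∈ m, Q j p := by
  cases m with
  | none =>
    exact (M.ae_sideMeasure_mem_cell i s).mono fun p hp => ⟨hQ i p hp, by simp⟩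
  | some j =>
    have h2 := M.ae_sideMeasure_mem_cell j s.opp
    rw [← he.2.1.sideMeasure_eq] at h2
    filter_upwards [M.ae_sideMeasure_mem_cell i s, h2] with p hp hp'
    exact ⟨hQ i p hp, by simpa using hQ j p hp'⟩

@[fun_prop]
theorem continuous_jumpFn (u : PW ι) (i : ι) (m : Option ι) : Continuous (jumpFn u i m) := by
  cases m <;> unfold jumpFn jump <;> fun_prop

theorem jumpFn_add (u v : PW ι) (i : ι) (m : Option ι) (p : ℝ × ℝ) :
    jumpFn (u + v) i m p = jumpFn u i m p + jumpFn v i m p := by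
  cases m <;> simp only [jumpFn, jump, Pi.add_apply u v, ev_add]; ring

theorem jumpFn_smul (r : ℝ) (u : PW ι) (i : ι) (m : Option ι) (p : ℝ × ℝ) :
    jumpFn (r • u) i m p = r * jumpFn u i m p := by
  cases m <;> simp only [jumpFn, jump, Pi.smul_apply r u, ev_smul]; ring

theorem avgFlux_add (u v : PW ι) (i : ι) (s : Side) (m : Option ι) (p : ℝ × ℝ) :
    M.avgFlux a (u + v) i s m p = M.avgFlux a u i s m p + M.avgFlux a v i s m p := by
  cases m <;> simp only [avgFlux, avg, Pi.add_apply u v, dot_grad_add] <;> ring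

theorem avgFlux_smul (r : ℝ) (u : PW ι) (i : ι) (s : Side) (m : Option ι) (p : ℝ × ℝ) :
    M.avgFlux a (r • u) i s m p = r * M.avgFlux a u i s m p := by
  cases m <;> simp only [avgFlux, avg, Pi.smul_apply r u, dot_grad_smul] <;> ring

theorem IsCoeff.integrable_avgFlux_mul_jumpFn (ha : M.IsCoeff a a₀ a₁) (h₀ : 0 ≤ a₀) {i : ι}
    {s : Side} {m : Option ι} (he : M.IsCoarseEdge i s m) (u v : PW ι) :
    Integrable (fun p => M.avgFlux a u i s m p * jumpFn v i m p) (M.sideMeasure i s) :=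
  ha.integrable_avg_mul h₀ he (F := fun j p => dot (grad (u j) p) s.normal)
    (fun j => by fun_prop) (by fun_prop)

theorem IsCoeff.integrable_avgCoeff_mul (ha : M.IsCoeff a a₀ a₁) (h₀ : 0 ≤ a₀) {i : ι}
    {s : Side} {m : Option ι} (he : M.IsCoarseEdge i s m) {J : ℝ × ℝ → ℝ} (hJ : Continuous J) :
    Integrable (fun p => M.avgCoeff a i m p * J p) (M.sideMeasure i s) := by
  simpa [avgCoeff] using
    ha.integrable_avg_mul h₀ he (F := fun _ _ => 1) (fun _ => continuous_const) hJ

theorem IsCoeff.ae_avgCoeff_mem (ha : M.IsCoeff a a₀ a₁) {i : ι}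
    {s : Side} {m : Option ι} (he : M.IsCoarseEdge i s m) :
    ∀ᵐ p ∂M.sideMeasure i s, M.avgCoeff a i m p ∈ Icc a₀ a₁ := by
  filter_upwards [he.ae_avg_of_forall (Q := fun j p => a (M.blk j) p ∈ Icc a₀ a₁)
    fun j p hp => ⟨ha.lower j p hp, ha.upper j p hp⟩] with p hp
  cases m with
  | none => simpa [avgCoeff, avg] using hp.1
  | some j =>
    have h1 := hp.1
    have h2 := hp.2 j rfl
    simp only [avgCoeff, avg, mem_Icc] at *
    constructor <;> linarith

/-! ### Sums over the coarse skeleton. -/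

variable [Fintype ι]

variable (M) in
open Classical in
/-- The pieces of coarse edges, as a finite set. -/
def coarseEdges : Finset (ι × Side × Option ι) :=
  Finset.univ.filter fun e => M.IsCoarseEdge e.1 e.2.1 e.2.2

theorem mem_coarseEdges {e : ι × Side × Option ι} :
    e ∈ M.coarseEdges ↔ M.IsCoarseEdge e.1 e.2.1 e.2.2 := by
  simp [coarseEdges]

theorem skeletonSum_eq (g : ι → Side → Option ι → ℝ × ℝ → ℝ) :
    M.skeletonSum g =
      ∑ e ∈ M.coarseEdges, ∫ p, g e.1 e.2.1 e.2.2 p ∂M.sideMeasure e.1 e.2.1 := by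
  simp [skeletonSum, coarseEdges, Finset.sum_filter, Fintype.sum_prod_type, sideIntegral_eq]

variable (M) in
/-- Integrability on each piece of a coarse edge. -/
def SkeletonIntegrable (g : ι → Side → Option ι → ℝ × ℝ → ℝ) : Prop :=
  ∀ i s m, M.IsCoarseEdge i s m → Integrable (g i s m) (M.sideMeasure i s)

theorem skeletonSum_add {g₁ g₂ : ι → Side → Option ι → ℝ × ℝ → ℝ} (h₁ : M.SkeletonIntegrable g₁)
    (h₂ : M.SkeletonIntegrable g₂) :
    M.skeletonSum (fun i s m p => g₁ i s m p + g₂ i s m p) =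
      M.skeletonSum g₁ + M.skeletonSum g₂ := by
  simp only [skeletonSum_eq, ← Finset.sum_add_distrib]
  exact Finset.sum_congr rfl fun e he =>
    integral_add (h₁ _ _ _ (mem_coarseEdges.1 he)) (h₂ _ _ _ (mem_coarseEdges.1 he))

theorem skeletonSum_const_mul (r : ℝ) (g : ι → Side → Option ι → ℝ × ℝ → ℝ) :
    M.skeletonSum (fun i s m p => r * g i s m p) = r * M.skeletonSum g := by
  simp only [skeletonSum_eq, Finset.mul_sum, integral_const_mul]

theorem skeletonSum_mono {g₁ g₂ : ι → Side → Option ι → ℝ × ℝ → ℝ} (h₁ : M.SkeletonIntegrable g₁)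
    (h₂ : M.SkeletonIntegrable g₂)
    (h : ∀ i s m, M.IsCoarseEdge i s m → ∀ᵐ p ∂M.sideMeasure i s, g₁ i s m p ≤ g₂ i s m p) :
    M.skeletonSum g₁ ≤ M.skeletonSum g₂ := by
  simp only [skeletonSum_eq]
  refine Finset.sum_le_sum fun e he => ?_
  have he' := mem_coarseEdges.1 he
  exact integral_mono_ae (h₁ _ _ _ he') (h₂ _ _ _ he') (h _ _ _ he')

theorem skeletonSum_nonneg {g : ι → Side → Option ι → ℝ × ℝ → ℝ}
    (h : ∀ i s m, M.IsCoarseEdge i s m → ∀ᵐ p ∂M.sideMeasure i s, 0 ≤ g i s m p) :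
    0 ≤ M.skeletonSum g := by
  simp only [skeletonSum_eq]
  exact Finset.sum_nonneg fun e he => integral_nonneg_of_ae (h _ _ _ (mem_coarseEdges.1 he))

end Mesh

theorem isBilinearMap_of_comm {E : Type*} [AddCommGroup E] [Module ℝ E] {B : E → E → ℝ}
    (hadd : ∀ u v w, B (u + v) w = B u w + B v w) (hsmul : ∀ (r : ℝ) u v, B (r • u) v = r * B u v)
    (hcomm : ∀ u v, B u v = B v u) : IsBilinearMap ℝ B where
  add_left := hadd
  smul_left := hsmul
  add_right u v w := by rw [hcomm, hadd, hcomm v, hcomm w]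
  smul_right r u v := by rw [hcomm, hsmul, hcomm v]; rfl

/-! ### The bilinear forms and their norms. -/

namespace Mesh

variable {ι κ : Type} {M : Mesh ι κ} {a : κ → ℝ × ℝ → ℝ} {a₀ a₁ : ℝ}

theorem integrableOn_cell (i : ι) {P : ℝ × ℝ → ℝ} (hP : Continuous P) :
    IntegrableOn P (M.cell i) :=
  hP.continuousOn.integrableOn_compact (M.isCompact_cell i)

theorem IsCoeff.skeletonIntegrable_penalty (ha : M.IsCoeff a a₀ a₁) (h₀ : 0 ≤ a₀) (u v : PW ι) :
    M.SkeletonIntegrable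
      (fun i _ m p => M.avgCoeff a i m p * (jumpFn u i m p * jumpFn v i m p)) :=
  fun _ _ _ he => ha.integrable_avgCoeff_mul h₀ he (by fun_prop)

theorem QuasiUniform.h_le {σ : ℝ} (hM : M.QuasiUniform σ) (hσ : 0 ≤ σ) (i : ι) :
    M.h ≤ σ * (M.x1 i - M.x0 i) ∧ M.h ≤ σ * (M.y1 i - M.y0 i) :=
  ⟨(hM i).trans (mul_le_mul_of_nonneg_left (min_le_left _ _) hσ),
    (hM i).trans (mul_le_mul_of_nonneg_left (min_le_right _ _) hσ)⟩

variable (M) in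
/-- The squared `L²` norm of the normal derivative on a side. -/
def normalEnergy (u : PW ι) (e : ι × Side) : ℝ :=
  ∫ p, dot (grad (u e.1) p) e.2.normal ^ 2 ∂M.sideMeasure e.1 e.2

theorem normalEnergy_nonneg (u : PW ι) (e : ι × Side) : 0 ≤ M.normalEnergy u e :=
  integral_nonneg fun _ => sq_nonneg _

/-- Fubini; the intended `g` is the squared `x`-derivative of a bilinear function, which depends on
`y` alone. -/
theorem setIntegral_cell_snd (i : ι) (g : ℝ → ℝ) :
    ∫ p in M.cell i, g p.2 = (M.x1 i - M.x0 i) * ∫ y in (M.y0 i)..(M.y1 i), g y := by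
  have h := setIntegral_prod_mul (μ := volume) (ν := volume) (fun _ : ℝ => (1 : ℝ)) g
    (Icc (M.x0 i) (M.x1 i)) (Icc (M.y0 i) (M.y1 i))
  rw [intervalIntegral.integral_of_le (M.hy i).le, ← integral_Icc_eq_integral_Ioc]
  simpa [cell, Measure.volume_eq_prod, (M.hx i).le] using h

theorem setIntegral_cell_fst (i : ι) (g : ℝ → ℝ) :
    ∫ p in M.cell i, g p.1 = (M.y1 i - M.y0 i) * ∫ x in (M.x0 i)..(M.x1 i), g x := by
  have h := setIntegral_prod_mul (μ := volume) (ν := volume) g (fun _ : ℝ => (1 : ℝ))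
    (Icc (M.x0 i) (M.x1 i)) (Icc (M.y0 i) (M.y1 i))
  rw [intervalIntegral.integral_of_le (M.hx i).le, ← integral_Icc_eq_integral_Ioc]
  simpa [cell, Measure.volume_eq_prod, (M.hy i).le, mul_comm] using h

theorem skeletonIntegrable_avg_normal (u : PW ι) : M.SkeletonIntegrable
    (fun i s m p => avg (fun j => dot (grad (u j) p) s.normal ^ 2) i m) := fun i s m _ => by
  refine integrable_side_of_continuous i s ?_
  cases m <;> simp only [avg] <;> fun_prop

/-- Convexity of the square: the square of a mean is at most the mean of the squares. -/
theorem avgFlux_sq_le (u : PW ι) {i : ι} {s : Side} {m : Option ι} {p : ℝ × ℝ} {c : ℝ}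
    (hi : |a (M.blk i) p| ≤ c) (hm : ∀ j ∈ m, |a (M.blk j) p| ≤ c) :
    M.avgFlux a u i s m p ^ 2 ≤
      c ^ 2 * avg (fun j => dot (grad (u j) p) s.normal ^ 2) i m := by
  have key : ∀ x y : ℝ, |x| ≤ c → (x * y) ^ 2 ≤ c ^ 2 * y ^ 2 := fun x y hx => by
    rw [mul_pow]
    exact mul_le_mul_of_nonneg_right (sq_le_sq' (abs_le.1 hx).1 (abs_le.1 hx).2) (sq_nonneg _)
  cases m with
  | none => exact key _ _ hi
  | some j =>
    have h1 := key _ (dot (grad (u i) p) s.normal) hi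
    have h2 := key _ (dot (grad (u j) p) s.normal) (hm j rfl)
    simp only [avgFlux, avg]
    nlinarith [sq_nonneg (a (M.blk i) p * dot (grad (u i) p) s.normal
      - a (M.blk j) p * dot (grad (u j) p) s.normal)]

variable [Fintype ι]

theorem l2_comm (u v : PW ι) : M.l2 u v = M.l2 v u := by
  simp only [l2, mul_comm]

theorem isBilinearMap_l2 : IsBilinearMap ℝ M.l2 := by
  refine isBilinearMap_of_comm (fun u v w => ?_) (fun r u v => ?_) l2_comm
  · simp only [l2, ← Finset.sum_add_distrib]
    refine Finset.sum_congr rfl fun i _ => ?_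
    rw [← integral_add (integrableOn_cell i (by fun_prop))
      (integrableOn_cell i (by fun_prop))]
    simp only [Pi.add_apply u v, ev_add, add_mul]
  · simp only [l2, Pi.smul_apply r u, ev_smul, mul_assoc, integral_const_mul, Finset.mul_sum]

theorem l2_self_nonneg (u : PW ι) : 0 ≤ M.l2 u u :=
  Finset.sum_nonneg fun _ _ => integral_nonneg fun _ => mul_self_nonneg _

theorem energy_comm (u v : PW ι) : M.energy a u v = M.energy a v u := by
  simp only [energy, dot_comm]

theorem IsCoeff.isBilinearMap_energy (ha : M.IsCoeff a a₀ a₁) (h₀ : 0 ≤ a₀) :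
    IsBilinearMap ℝ (M.energy a) := by
  refine isBilinearMap_of_comm (fun u v w => ?_) (fun r u v => ?_) energy_comm
  · simp only [energy, ← Finset.sum_add_distrib]
    refine Finset.sum_congr rfl fun i _ => ?_
    rw [← integral_add (ha.integrableOn_mul h₀ i (by fun_prop))
      (ha.integrableOn_mul h₀ i (by fun_prop))]
    simp only [Pi.add_apply u v, dot_grad_add, mul_add]
  · simp only [energy, Pi.smul_apply r u, dot_grad_smul, mul_left_comm _ r, integral_const_mul,
      Finset.mul_sum]

theorem IsCoeff.energy_self_nonneg (ha : M.IsCoeff a a₀ a₁) (h₀ : 0 ≤ a₀) (u : PW ι) :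
    0 ≤ M.energy a u u :=
  Finset.sum_nonneg fun i _ => setIntegral_nonneg (M.measurableSet_cell i) fun p hp =>
    mul_nonneg (h₀.trans (ha.lower i p hp)) (dot_self_nonneg _)

/-- Coefficients that are comparable on all cells give comparable energies. -/
theorem energy_self_le_mul {b : κ → ℝ × ℝ → ℝ} {b₀ b₁ c : ℝ} (ha : M.IsCoeff a a₀ a₁)
    (h₀ : 0 ≤ a₀) (hb : M.IsCoeff b b₀ b₁) (hb₀ : 0 ≤ b₀)
    (hab : ∀ i, ∀ p ∈ M.cell i, a (M.blk i) p ≤ c * b (M.blk i) p) (u : PW ι) :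
    M.energy a u u ≤ c * M.energy b u u := by
  simp only [energy, Finset.mul_sum, ← integral_const_mul]
  refine Finset.sum_le_sum fun i _ => setIntegral_mono_on (ha.integrableOn_mul h₀ i (by fun_prop))
    ((hb.integrableOn_mul hb₀ i (by fun_prop)).const_mul c) (M.measurableSet_cell i) fun p hp => ?_
  rw [← mul_assoc]
  exact mul_le_mul_of_nonneg_right (hab i p hp) (dot_self_nonneg _)

variable (M) in
/-- The consistency term `∑_e ∫_e {a ∇u · n} [v]`. -/
def consistency (a : κ → ℝ × ℝ → ℝ) (u v : PW ι) : ℝ :=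
  M.skeletonSum (fun i s m p => M.avgFlux a u i s m p * jumpFn v i m p)

variable (M) in
/-- The penalty term `∑_e ∫_e a [u] [v]`. -/
def penalty (a : κ → ℝ × ℝ → ℝ) (u v : PW ι) : ℝ :=
  M.skeletonSum (fun i _ m p => M.avgCoeff a i m p * (jumpFn u i m p * jumpFn v i m p))

theorem IsCoeff.isBilinearMap_consistency (ha : M.IsCoeff a a₀ a₁) (h₀ : 0 ≤ a₀) :
    IsBilinearMap ℝ (M.consistency a) where
  add_left u v w := by
    unfold consistency
    rw [← skeletonSum_add (fun i s m he => ha.integrable_avgFlux_mul_jumpFn h₀ he u w)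
      (fun i s m he => ha.integrable_avgFlux_mul_jumpFn h₀ he v w)]
    simp only [avgFlux_add, add_mul]
  smul_left r u v := by
    simp only [consistency, smul_eq_mul, ← skeletonSum_const_mul, avgFlux_smul, mul_assoc]
  add_right u v w := by
    unfold consistency
    rw [← skeletonSum_add (fun i s m he => ha.integrable_avgFlux_mul_jumpFn h₀ he u v)
      (fun i s m he => ha.integrable_avgFlux_mul_jumpFn h₀ he u w)]
    simp only [jumpFn_add, mul_add]
  smul_right r u v := by
    simp only [consistency, smul_eq_mul, ← skeletonSum_const_mul, jumpFn_smul, mul_left_comm]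

theorem penalty_comm (u v : PW ι) : M.penalty a u v = M.penalty a v u := by
  simp only [penalty, mul_comm]

theorem IsCoeff.isBilinearMap_penalty (ha : M.IsCoeff a a₀ a₁) (h₀ : 0 ≤ a₀) :
    IsBilinearMap ℝ (M.penalty a) := by
  refine isBilinearMap_of_comm (fun u v w => ?_) (fun r u v => ?_) penalty_comm
  · unfold penalty
    rw [← skeletonSum_add (ha.skeletonIntegrable_penalty h₀ u w)
      (ha.skeletonIntegrable_penalty h₀ v w)]
    simp only [jumpFn_add, add_mul, mul_add]
  · simp only [penalty, ← skeletonSum_const_mul, jumpFn_smul, mul_assoc, mul_left_comm r]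

theorem IsCoeff.penalty_self_nonneg (ha : M.IsCoeff a a₀ a₁) (h₀ : 0 ≤ a₀) (u : PW ι) :
    0 ≤ M.penalty a u u :=
  skeletonSum_nonneg fun _ _ _ he => (ha.ae_avgCoeff_mem he).mono fun _ hp =>
    mul_nonneg (h₀.trans hp.1) (mul_self_nonneg _)

theorem IsCoeff.penalty_self_le_mul (ha : M.IsCoeff a a₀ a₁) (h₀ : 0 ≤ a₀) (u : PW ι) :
    M.penalty a u u ≤ a₁ * M.penalty (fun _ _ => 1) u u := by
  unfold penalty
  rw [← skeletonSum_const_mul]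
  refine skeletonSum_mono (ha.skeletonIntegrable_penalty h₀ u u)
    (fun i s m he =>
      (isCoeff_one.skeletonIntegrable_penalty zero_le_one u u i s m he).const_mul a₁)
    fun i s m he => ?_
  filter_upwards [ha.ae_avgCoeff_mem he, isCoeff_one.ae_avgCoeff_mem he] with p hp hp'
  -- The averaged coefficient for `a = 1` lies in `[1, 1]`.
  rw [le_antisymm hp'.2 hp'.1, one_mul]
  exact mul_le_mul_of_nonneg_right hp.2 (mul_self_nonneg _)

theorem aDG_eq (γ : ℝ) (u v : PW ι) :
    M.aDG a γ u v = M.energy a u v - M.consistency a u v - M.consistency a v u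
      + γ / M.h * M.penalty a u v := rfl

theorem aDG_comm (γ : ℝ) (u v : PW ι) : M.aDG a γ u v = M.aDG a γ v u := by
  rw [aDG_eq, aDG_eq, energy_comm, penalty_comm]; ring

theorem IsCoeff.isBilinearMap_aDG (ha : M.IsCoeff a a₀ a₁) (h₀ : 0 ≤ a₀) (γ : ℝ) :
    IsBilinearMap ℝ (M.aDG a γ) := by
  have hE := ha.isBilinearMap_energy h₀
  have hC := ha.isBilinearMap_consistency h₀
  have hP := ha.isBilinearMap_penalty h₀
  refine isBilinearMap_of_comm (fun u v w => ?_) (fun r u v => ?_) (aDG_comm γ)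
  · simp only [aDG_eq, hE.add_left, hC.add_left, hC.add_right, hP.add_left]; ring
  · simp only [aDG_eq, hE.smul_left, hC.smul_left, hC.smul_right, hP.smul_left, smul_eq_mul]; ring

variable (M) in
/-- The inner product of the `a`-norm. -/
def aInner (a : κ → ℝ × ℝ → ℝ) (γ : ℝ) (u v : PW ι) : ℝ :=
  M.energy a u v + γ / M.h * M.penalty a u v

theorem aInner_comm (γ : ℝ) (u v : PW ι) : M.aInner a γ u v = M.aInner a γ v u := by
  rw [aInner, aInner, energy_comm, penalty_comm]

theorem IsCoeff.isBilinearMap_aInner (ha : M.IsCoeff a a₀ a₁) (h₀ : 0 ≤ a₀) (γ : ℝ) :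
    IsBilinearMap ℝ (M.aInner a γ) := by
  have hE := ha.isBilinearMap_energy h₀
  have hP := ha.isBilinearMap_penalty h₀
  refine isBilinearMap_of_comm (fun u v w => ?_) (fun r u v => ?_) (aInner_comm γ)
  · simp only [aInner, hE.add_left, hP.add_left]; ring
  · simp only [aInner, hE.smul_left, hP.smul_left, smul_eq_mul]; ring

theorem aNorm_eq (γ : ℝ) (u : PW ι) : M.aNorm a γ u = √(M.aInner a γ u u) := by
  simp only [aNorm, aInner, penalty, sq]

theorem h1Norm_eq (γ : ℝ) (u : PW ι) : M.h1Norm γ u = √(M.aInner (fun _ _ => 1) γ u u) := by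
  have h : ∀ i m p, M.avgCoeff (fun _ _ => 1) i m p = 1 := fun i m p => by
    cases m <;> norm_num [avgCoeff, avg]
  simp only [h1Norm, aInner, penalty, energy, sq, h, one_mul]

theorem l2Norm_eq (u : PW ι) : M.l2Norm u = √(M.l2 u u) := rfl

variable (M) in
theorem side_le_h (i : ι) : M.x1 i - M.x0 i ≤ M.h ∧ M.y1 i - M.y0 i ≤ M.h := by
  have h := le_ciSup (Set.finite_range fun i => max (M.x1 i - M.x0 i) (M.y1 i - M.y0 i)).bddAbove i
  exact ⟨(le_max_left _ _).trans h, (le_max_right _ _).trans h⟩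

variable (M) in
theorem h_pos [Nonempty ι] : 0 < M.h := by
  obtain ⟨i⟩ := ‹Nonempty ι›
  linarith [M.hx i, (M.side_le_h i).1]

theorem IsCoeff.aInner_self_nonneg [Nonempty ι] (ha : M.IsCoeff a a₀ a₁) (h₀ : 0 ≤ a₀) {γ : ℝ}
    (hγ : 0 ≤ γ) (u : PW ι) : 0 ≤ M.aInner a γ u u :=
  add_nonneg (ha.energy_self_nonneg h₀ u)
    (mul_nonneg (div_nonneg hγ M.h_pos.le) (ha.penalty_self_nonneg h₀ u))

theorem IsCoeff.aInner_self_le [Nonempty ι] (ha : M.IsCoeff a a₀ a₁) (h₀ : 0 ≤ a₀) {γ : ℝ}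
    (hγ : 0 ≤ γ) (u : PW ι) : M.aInner a γ u u ≤ a₁ * M.aInner (fun _ _ => 1) γ u u := by
  have h1 := energy_self_le_mul ha h₀ isCoeff_one zero_le_one (c := a₁)
    (fun i p hp => by simpa using ha.upper i p hp) u
  have h2 := mul_le_mul_of_nonneg_left (ha.penalty_self_le_mul h₀ u)
    (div_nonneg hγ M.h_pos.le)
  simp only [aInner]
  linarith

/-! ### Coercivity -/

/-- The discrete trace inequality on a cell. -/
theorem QuasiUniform.sum_normalEnergy_le {σ : ℝ} (hM : M.QuasiUniform σ) (hσ : 0 ≤ σ) (u : PW ι)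
    (i : ι) : M.h * ∑ s, M.normalEnergy u (i, s) ≤
      2 * σ * ∫ p in M.cell i, dot (grad (u i) p) (grad (u i) p) := by
  -- Opposite sides have equal normal energies: `X` on left and right, `Y` on bottom and top. This
  -- double counting gives the 2 in `2 * σ`; the `σ` comes from `h ≤ σ` times the side length.
  set X := ∫ y in (M.y0 i)..(M.y1 i), (u i 1 + u i 3 * y) ^ 2 with hX
  set Y := ∫ x in (M.x0 i)..(M.x1 i), (u i 2 + u i 3 * x) ^ 2 with hY
  have hl : M.normalEnergy u (i, .left) = X := by
    rw [normalEnergy, ← sideIntegral_eq]; simp only [sideIntegral, dot, grad, Side.normal, hX]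
    ring_nf
  have hr : M.normalEnergy u (i, .right) = X := by
    rw [normalEnergy, ← sideIntegral_eq]; simp [sideIntegral, dot, grad, Side.normal, hX]
  have hb : M.normalEnergy u (i, .bottom) = Y := by
    rw [normalEnergy, ← sideIntegral_eq]; simp only [sideIntegral, dot, grad, Side.normal, hY]
    ring_nf
  have ht : M.normalEnergy u (i, .top) = Y := by
    rw [normalEnergy, ← sideIntegral_eq]; simp [sideIntegral, dot, grad, Side.normal, hY]
  have hX0 : 0 ≤ X := hl ▸ normalEnergy_nonneg u _
  have hY0 : 0 ≤ Y := hb ▸ normalEnergy_nonneg u _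
  have hcell : ∫ p in M.cell i, dot (grad (u i) p) (grad (u i) p) =
      (M.x1 i - M.x0 i) * X + (M.y1 i - M.y0 i) * Y := by
    rw [hX, hY, ← setIntegral_cell_snd i fun y => (u i 1 + u i 3 * y) ^ 2,
      ← setIntegral_cell_fst i fun x => (u i 2 + u i 3 * x) ^ 2,
      ← integral_add (integrableOn_cell i (by fun_prop))
        (integrableOn_cell i (by fun_prop))]
    simp only [dot, grad, sq]
  have hsum : ∑ s, M.normalEnergy u (i, s) = 2 * X + 2 * Y := by
    have : (Finset.univ : Finset Side) =
        ⟨([.left, .right, .bottom, .top] : List Side), by simp⟩ := rfl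
    rw [this]
    simp only [Finset.sum, Multiset.map_coe, Multiset.sum_coe, List.map_cons, List.map_nil,
      List.sum_cons, List.sum_nil, hl, hr, hb, ht]
    ring
  have h1 := mul_le_mul_of_nonneg_right (hM.h_le hσ i).1 hX0
  have h2 := mul_le_mul_of_nonneg_right (hM.h_le hσ i).2 hY0
  rw [hsum, hcell]
  linarith

/-- Injectivity means that each side of each cell is charged at most once. -/
theorem sum_coarseEdges_le {S : ι × Side → ℝ} (hS : ∀ e, 0 ≤ S e)
    {φ : ι × Side × Option ι → ι × Side} (hφ : Set.InjOn φ M.coarseEdges) :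
    ∑ e ∈ M.coarseEdges, S (φ e) ≤ ∑ i, ∑ s, S (i, s) := by
  classical
  rw [← Fintype.sum_prod_type, ← Finset.sum_image (g := φ) (f := S) hφ]
  exact Finset.sum_le_univ_sum_of_nonneg hS

theorem injOn_coarseEdges_near :
    Set.InjOn (fun e : ι × Side × Option ι => (e.1, e.2.1)) M.coarseEdges := by
  rintro ⟨i, s, m⟩ h ⟨i', s', m'⟩ h' heq
  obtain ⟨rfl, rfl⟩ := Prod.mk.inj heq
  replace h : M.IsCoarseEdge i s m := mem_coarseEdges.1 h
  replace h' : M.IsCoarseEdge i s m' := mem_coarseEdges.1 h'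
  cases m with
  | none =>
    cases m' with
    | none => rfl
    | some j' => exact absurd h'.2.1 (h j')
  | some j =>
    cases m' with
    | none => exact absurd h.2.1 (h' j)
    | some j' => rw [h.2.1.unique h'.2.1]

/-- The side of a coarse edge piece, seen from the cell on the far side if there is one. -/
def farSide (e : ι × Side × Option ι) : ι × Side :=
  e.2.2.elim (e.1, e.2.1) fun j => (j, e.2.1.opp)

/-- An interior piece is recovered by crossing back to its unique neighbour. It cannot collide with
a boundary piece, whose side has no neighbour. -/
theorem injOn_coarseEdges_far : Set.InjOn (farSide (ι := ι)) M.coarseEdges := by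
  rintro ⟨i, s, m⟩ h ⟨i', s', m'⟩ h' heq
  replace h : M.IsCoarseEdge i s m := mem_coarseEdges.1 h
  replace h' : M.IsCoarseEdge i' s' m' := mem_coarseEdges.1 h'
  cases m with
  | none =>
    cases m' with
    | none => obtain ⟨rfl, rfl⟩ := Prod.mk.inj heq; rfl
    | some j' =>
      obtain ⟨rfl, rfl⟩ : i = j' ∧ s = s'.opp := Prod.mk.inj heq
      exact absurd h'.2.1.symm (h i')
  | some j =>
    cases m' with
    | none =>
      obtain ⟨rfl, rfl⟩ : j = i' ∧ s.opp = s' := Prod.mk.inj heq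
      exact absurd h.2.1.symm (h' i)
    | some j' =>
      obtain ⟨rfl, hs⟩ : j = j' ∧ s.opp = s'.opp := Prod.mk.inj heq
      obtain rfl := Side.opp_injective hs
      rw [h.2.1.symm.unique h'.2.1.symm]

/-- Each edge term is the mean of its near and far normal energies, and each of the two families
injects into all cell sides. On the boundary `farSide` is the near side, so the mean is still
correct. -/
theorem skeletonSum_avg_normal_le (u : PW ι) :
    M.skeletonSum (fun i s m p => avg (fun j => dot (grad (u j) p) s.normal ^ 2) i m) ≤
      ∑ i, ∑ s, M.normalEnergy u (i, s) := by
  have hnear := sum_coarseEdges_le (normalEnergy_nonneg (M := M) u)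
    (injOn_coarseEdges_near (M := M))
  have hfar := sum_coarseEdges_le (normalEnergy_nonneg (M := M) u)
    (injOn_coarseEdges_far (M := M))
  have hsum : M.skeletonSum (fun i s m p => avg (fun j => dot (grad (u j) p) s.normal ^ 2) i m) =
      ∑ e ∈ M.coarseEdges,
        (M.normalEnergy u (e.1, e.2.1) + M.normalEnergy u (farSide e)) / 2 := by
    rw [skeletonSum_eq]
    refine Finset.sum_congr rfl fun ⟨i, s, m⟩ he => ?_
    have he := mem_coarseEdges.1 he
    cases m with
    | none => simp only [avg, farSide, normalEnergy, Option.elim]; ring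
    | some j =>
      have hj : M.normalEnergy u (j, s.opp) =
          ∫ p, dot (grad (u j) p) s.normal ^ 2 ∂M.sideMeasure i s := by
        simp only [normalEnergy, ← he.2.1.sideMeasure_eq, dot_opp_normal, neg_sq]
      simp only [avg, farSide, Option.elim, hj, integral_div]
      rw [integral_add (integrable_side_of_continuous i s (by fun_prop))
        (integrable_side_of_continuous i s (by fun_prop))]
      rfl
  rw [hsum, ← Finset.sum_div, Finset.sum_add_distrib]
  linarith

/-- Young's inequality for the consistency term. -/
theorem IsCoeff.abs_consistency_le [Nonempty ι] {σ : ℝ} (hM : M.QuasiUniform σ) (hσ : 1 ≤ σ)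
    (ha : M.IsCoeff a a₀ a₁) (h₀ : 0 < a₀) (h₁ : a₀ ≤ a₁) (u : PW ι) :
    2 * |M.consistency a u u| ≤
      M.energy a u u / 2 + 4 * a₁ ^ 2 * σ / a₀ ^ 2 / M.h * M.penalty a u u := by
  have hh := M.h_pos
  have ha₁ : 0 < a₁ := h₀.trans_le h₁
  have hσ0 : 0 < σ := by linarith
  -- Young's parameter, chosen so that the trace inequality turns the flux part into at most half
  -- the energy.
  set δ := a₀ * M.h / (4 * a₁ ^ 2 * σ) with hδ
  have hδ0 : 0 < δ := by positivity
  set N : ι → Side → Option ι → ℝ × ℝ → ℝ :=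
    fun i s m p => avg (fun j => dot (grad (u j) p) s.normal ^ 2) i m with hN
  -- The signs `τ = 1` and `τ = -1` together give the absolute value.
  have hyoung : ∀ τ : ℝ, τ ^ 2 = 1 → τ * (2 * M.consistency a u u) ≤
      δ * a₁ ^ 2 * M.skeletonSum N + 1 / (δ * a₀) * M.penalty a u u := fun τ hτ => by
    unfold consistency penalty
    rw [← mul_assoc, ← skeletonSum_const_mul, ← skeletonSum_const_mul, ← skeletonSum_const_mul,
      ← skeletonSum_add
        (fun i s m he => (skeletonIntegrable_avg_normal u i s m he).const_mul _)
        (fun i s m he => (ha.skeletonIntegrable_penalty h₀.le u u i s m he).const_mul _)]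
    refine skeletonSum_mono
      (fun i s m he => (ha.integrable_avgFlux_mul_jumpFn h₀.le he u u).const_mul _)
      (fun i s m he => ((skeletonIntegrable_avg_normal u i s m he).const_mul _).add
        ((ha.skeletonIntegrable_penalty h₀.le u u i s m he).const_mul _))
      fun i s m he => ?_
    filter_upwards [ha.ae_avgCoeff_mem he, he.ae_avg_of_forall
      (Q := fun j p => |a (M.blk j) p| ≤ a₁) fun j p hp => ha.norm_le h₀.le j p hp] with p hp hp'
    have hF := avgFlux_sq_le u (s := s) hp'.1 hp'.2
    set F := M.avgFlux a u i s m p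
    set J := jumpFn u i m p
    have hJ : 1 / (δ * a₀) * (a₀ * (J * J)) ≤ 1 / (δ * a₀) * (M.avgCoeff a i m p * (J * J)) :=
      mul_le_mul_of_nonneg_left (mul_le_mul_of_nonneg_right hp.1 (mul_self_nonneg _))
        (by positivity)
    have hJ' : 1 / (δ * a₀) * (a₀ * (J * J)) = J ^ 2 / δ := by field_simp
    -- Completing the square is Young's inequality; the lower bound `a₀` then converts `J ^ 2 / δ`
    -- into the penalty density.
    have hsq : δ * F ^ 2 + J ^ 2 / δ - τ * 2 * (F * J) = δ * (F - τ * J / δ) ^ 2 := by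
      field_simp
      linear_combination (-J ^ 2) * hτ
    have : 0 ≤ δ * (F - τ * J / δ) ^ 2 := by positivity
    have hF' := mul_le_mul_of_nonneg_left hF hδ0.le
    simp only [hN] at *
    linarith
  have hNle : δ * a₁ ^ 2 * M.skeletonSum N ≤ M.energy a u u / 2 := by
    have h1 : M.h * M.skeletonSum N ≤ 2 * σ * M.energy (fun _ _ => 1) u u := by
      refine (mul_le_mul_of_nonneg_left (skeletonSum_avg_normal_le u) hh.le).trans ?_
      rw [energy, Finset.mul_sum, Finset.mul_sum]
      refine Finset.sum_le_sum fun i _ => ?_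
      simpa only [one_mul] using hM.sum_normalEnergy_le hσ0.le u i
    have h2 : a₀ * M.energy (fun _ _ => 1) u u ≤ M.energy a u u := by
      have := energy_self_le_mul isCoeff_one zero_le_one ha h₀.le (c := a₀⁻¹)
        (fun i p hp => by rw [← div_eq_inv_mul, one_le_div h₀]; exact ha.lower i p hp) u
      rwa [← div_eq_inv_mul, le_div_iff₀' h₀] at this
    have h3 : δ * a₁ ^ 2 * M.skeletonSum N = a₀ / (4 * σ) * (M.h * M.skeletonSum N) := by
      rw [hδ]; field_simp
    rw [h3]
    calc a₀ / (4 * σ) * (M.h * M.skeletonSum N)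
        ≤ a₀ / (4 * σ) * (2 * σ * M.energy (fun _ _ => 1) u u) :=
          mul_le_mul_of_nonneg_left h1 (by positivity)
      _ = a₀ * M.energy (fun _ _ => 1) u u / 2 := by field_simp; ring
      _ ≤ M.energy a u u / 2 := by linarith
  have hcoef : 1 / (δ * a₀) = 4 * a₁ ^ 2 * σ / a₀ ^ 2 / M.h := by
    rw [hδ]; field_simp
  have hp := hyoung 1 (by norm_num)
  have hn := hyoung (-1) (by norm_num)
  rw [hcoef] at hp hn
  have : |2 * M.consistency a u u| ≤
      M.energy a u u / 2 + 4 * a₁ ^ 2 * σ / a₀ ^ 2 / M.h * M.penalty a u u :=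
    abs_le'.2 ⟨by linarith, by linarith⟩
  rwa [abs_mul, abs_two] at this

/-- Coercivity and continuity of `a_DG` with respect to the `a`-norm. -/
theorem IsCoeff.aDG_self_mem [Nonempty ι] {σ γ : ℝ} (hM : M.QuasiUniform σ) (hσ : 1 ≤ σ)
    (ha : M.IsCoeff a a₀ a₁) (h₀ : 0 < a₀) (h₁ : a₀ ≤ a₁)
    (hγ : 8 * a₁ ^ 2 * σ / a₀ ^ 2 ≤ γ) (u : PW ι) :
    M.aInner a γ u u ≤ 2 * M.aDG a γ u u ∧ M.aDG a γ u u ≤ 2 * M.aInner a γ u u := by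
  have hc := ha.abs_consistency_le hM hσ h₀ h₁ u
  have hE := ha.energy_self_nonneg h₀.le u
  have hP := ha.penalty_self_nonneg h₀.le u
  -- The threshold for `γ` is twice Young's constant, so the two consistency terms cost at most half
  -- of `aInner`. Thus `a_DG` lies between 1/2 and 3/2 of it.
  have hle : 4 * a₁ ^ 2 * σ / a₀ ^ 2 / M.h * M.penalty a u u ≤
      γ / M.h * M.penalty a u u / 2 := by
    have : 4 * a₁ ^ 2 * σ / a₀ ^ 2 / M.h ≤ γ / M.h / 2 := by
      rw [div_right_comm γ]
      refine div_le_div_of_nonneg_right ?_ M.h_pos.le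
      rw [le_div_iff₀ two_pos]
      exact le_trans (le_of_eq (by ring)) hγ
    calc _ ≤ γ / M.h / 2 * M.penalty a u u := mul_le_mul_of_nonneg_right this hP
      _ = _ := by ring
  have h1 := le_abs_self (M.consistency a u u)
  have h2 := neg_abs_le (M.consistency a u u)
  rw [aDG_eq, aInner]
  have hγ0 : 0 ≤ γ / M.h * M.penalty a u u := by
    have : 0 ≤ 4 * a₁ ^ 2 * σ / a₀ ^ 2 / M.h * M.penalty a u u := by
      have := M.h_pos
      positivity
    linarith
  constructor <;> linarith

end Mesh

/-! ### The energy method for abstract second-order evolution equations. -/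

section Abstract

variable {E : Type*} [NormedAddCommGroup E] [NormedSpace ℝ E] {B m D : E → E → ℝ}

/-- Cauchy–Schwarz, which needs only semidefiniteness. -/
theorem bilin_sq_le (hB : IsBilinearMap ℝ B) (hc : ∀ u v, B u v = B v u) (h0 : ∀ u, 0 ≤ B u u)
    (u v : E) : B u v ≤ √(B u u) * √(B v v) := by
  have h := LinearMap.BilinForm.apply_sq_le_of_symm hB.toLinearMap h0 ⟨hc⟩ u v
  rw [← Real.sqrt_mul (h0 u)]
  exact Real.le_sqrt_of_sq_le h

theorem sqrt_bilin_sub_le (hB : IsBilinearMap ℝ B) (hc : ∀ u v, B u v = B v u)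
    (h0 : ∀ u, 0 ≤ B u u) (u v : E) :
    √(B (u - v) (u - v)) ≤ √(B u u) + √(B v v) := by
  have hneg : ∀ x y, B (-x) y = -B x y := fun x y => by
    simpa using hB.smul_left (-1) x y
  have hneg' : ∀ x y, B x (-y) = -B x y := fun x y => by rw [hc, hneg, hc]
  have h := bilin_sq_le hB hc h0 u (-v)
  simp only [hneg, hneg', neg_neg] at h
  refine Real.sqrt_le_iff.2 ⟨by positivity, ?_⟩
  rw [add_sq, Real.sq_sqrt (h0 u), Real.sq_sqrt (h0 v), sub_eq_add_neg, hB.add_left, hB.add_right,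
    hB.add_right, hneg, hneg', hneg, hneg', hc v u]
  linarith

theorem sqrt_add_le_sqrt_add_sqrt {x y : ℝ} (hx : 0 ≤ x) (hy : 0 ≤ y) :
    √(x + y) ≤ √x + √y := by
  refine Real.sqrt_le_iff.2 ⟨by positivity, ?_⟩
  rw [add_sq, Real.sq_sqrt hx, Real.sq_sqrt hy]
  have : 0 ≤ 2 * √x * √y := by positivity
  linarith

variable [FiniteDimensional ℝ E]

/-- The product rule applies because finite dimension makes every bilinear map continuous. -/
theorem hasDerivWithinAt_bilin_self (hB : IsBilinearMap ℝ B) (hc : ∀ u v, B u v = B v u)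
    {u : ℝ → E} {u' : E} {s : Set ℝ} {t : ℝ} (hu : HasDerivWithinAt u u' s t) :
    HasDerivWithinAt (fun t => B (u t) (u t)) (2 * B (u t) u') s t := by
  have h := hB.toContinuousBilinearMap.hasDerivWithinAt_of_bilinear hu hu
  simp only [IsBilinearMap.toContinuousBilinearMap_apply, hc u' (u t), ← two_mul] at h
  exact h

theorem continuousOn_sqrt_bilin_self (hB : IsBilinearMap ℝ B) {u : ℝ → E} {s : Set ℝ}
    (hu : ContinuousOn u s) : ContinuousOn (fun t => √(B (u t) (u t))) s := by
  have h : ContinuousOn (fun t => hB.toContinuousBilinearMap (u t) (u t)) s := by fun_prop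
  exact h.sqrt

/-- The energy estimate for `m (ξ'', ·) + D (ξ, ·) = m (g, ·)`. -/
theorem sqrt_energy_le (hm : IsBilinearMap ℝ m) (hmc : ∀ u v, m u v = m v u)
    (hm0 : ∀ u, 0 ≤ m u u) (hD : IsBilinearMap ℝ D) (hDc : ∀ u v, D u v = D v u)
    (hD0 : ∀ u, 0 ≤ D u u) {T : ℝ} {ξ ξ' ξ'' g : ℝ → E}
    (hξ : ∀ t ∈ Icc 0 T, HasDerivWithinAt ξ (ξ' t) (Icc 0 T) t)
    (hξ' : ∀ t ∈ Icc 0 T, HasDerivWithinAt ξ' (ξ'' t) (Icc 0 T) t)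
    (hg : IntervalIntegrable (fun t => √(m (g t) (g t))) volume 0 T)
    (heq : ∀ t ∈ Icc 0 T, m (ξ'' t) (ξ' t) + D (ξ t) (ξ' t) = m (g t) (ξ' t))
    {t : ℝ} (ht : t ∈ Icc 0 T) :
    √(m (ξ' t) (ξ' t) + D (ξ t) (ξ t)) ≤
      √(m (ξ' 0) (ξ' 0) + D (ξ 0) (ξ 0)) + ∫ s in (0 : ℝ)..T, √(m (g s) (g s)) := by
  set W : ℝ → ℝ := fun t => m (ξ' t) (ξ' t) + D (ξ t) (ξ t) with hW
  have hW0 : ∀ t, 0 ≤ W t := fun t => add_nonneg (hm0 _) (hD0 _)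
  have hWd : ∀ s ∈ Icc 0 T, HasDerivWithinAt W (2 * m (g s) (ξ' s)) (Icc 0 T) s := fun s hs => by
    refine ((hasDerivWithinAt_bilin_self hm hmc (hξ' s hs)).add
      (hasDerivWithinAt_bilin_self hD hDc (hξ s hs))).congr_deriv ?_
    rw [← heq s hs, hmc (ξ' s)]; ring
  have hsub : Icc 0 t ⊆ Icc 0 T := Icc_subset_Icc_right ht.2
  -- The shift by `δ` keeps the square root differentiable where `W` vanishes.
  have hmain : ∀ δ : ℝ, 0 < δ → √(W t + δ) ≤ √(W 0 + δ) + ∫ s in (0 : ℝ)..T, √(m (g s) (g s)) := by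
    intro δ hδ
    have hpos : ∀ s, 0 < W s + δ := fun s => add_pos_of_nonneg_of_pos (hW0 s) hδ
    have hFd : ∀ s ∈ Icc 0 T, HasDerivWithinAt (fun s => √(W s + δ))
        (2 * m (g s) (ξ' s) / (2 * √(W s + δ))) (Icc 0 T) s := fun s hs =>
      ((hWd s hs).add_const δ).sqrt (hpos s).ne'
    have hint : IntervalIntegrable (fun t => √(m (g t) (g t))) volume 0 t :=
      hg.mono_set (by rw [uIcc_of_le ht.1, uIcc_of_le (ht.1.trans ht.2)]; exact hsub)
    -- This form of the fundamental theorem requires only an integrable upper bound for the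
    -- derivative, so `ξ''` need not be continuous or integrable.
    have h1 := intervalIntegral.sub_le_integral_of_hasDeriv_right_of_le ht.1
      (g := fun s => √(W s + δ)) (φ := fun s => √(m (g s) (g s)))
      (fun s hs => ((hFd s (hsub hs)).continuousWithinAt).mono hsub)
      (fun s hs => ((hFd s (hsub (Ioo_subset_Icc_self hs))).hasDerivAt
        (Icc_mem_nhds hs.1 (hs.2.trans_le ht.2))).hasDerivWithinAt)
      ((intervalIntegrable_iff_integrableOn_Icc_of_le ht.1).1 hint)
      (fun s hs => by
        have hs0 : 0 < √(W s + δ) := Real.sqrt_pos.2 (hpos s)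
        rw [mul_div_mul_left _ _ two_ne_zero, div_le_iff₀ hs0]
        refine (bilin_sq_le hm hmc hm0 _ _).trans
          (mul_le_mul_of_nonneg_left (Real.sqrt_le_sqrt ?_) (Real.sqrt_nonneg _))
        have := hD0 (ξ s)
        simp only [hW]
        linarith)
    have h2 := intervalIntegral.integral_mono_interval (μ := volume)
      (f := fun s => √(m (g s) (g s))) le_rfl ht.1 ht.2
      (.of_forall fun s => Real.sqrt_nonneg _) hg
    linarith
  refine le_of_forall_pos_le_add fun e he => ?_
  have h := hmain (e ^ 2) (by positivity)
  have h1 : √(W t) ≤ √(W t + e ^ 2) := Real.sqrt_le_sqrt (by linarith [sq_nonneg e])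
  have h2 : √(W 0 + e ^ 2) ≤ √(W 0) + e := by
    simpa [Real.sqrt_sq he.le] using sqrt_add_le_sqrt_add_sqrt (hW0 0) (sq_nonneg e)
  linarith

end Abstract

/-- Difference quotients stay in `V`, and finite-dimensional subspaces are closed. This makes `ξ_t`
an admissible test function. -/
theorem derivWithin_mem_submodule {E : Type*} [NormedAddCommGroup E] [NormedSpace ℝ E]
    [FiniteDimensional ℝ E] (V : Submodule ℝ E) {u : ℝ → E} {s : Set ℝ} (hu : ∀ t ∈ s, u t ∈ V)
    (t : ℝ) : derivWithin u s t ∈ V := by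
  have h := range_derivWithin_subset_closure_span_image u (s := s) (t := s)
    (by simpa using subset_closure) ⟨t, rfl⟩
  have hle : Submodule.span ℝ (u '' s) ≤ V :=
    Submodule.span_le.2 (by rintro _ ⟨t, ht, rfl⟩; exact hu t ht)
  exact V.closed_of_finiteDimensional.closure_subset_iff.2 hle h

/-! ### Time derivatives and maxima. -/

section Time

variable {ι : Type} [Fintype ι] {T : ℝ} {u v : ℝ → PW ι}

theorem dt_sub (hu : DifferentiableOn ℝ u (Icc 0 T))
    (hv : DifferentiableOn ℝ v (Icc 0 T)) {t : ℝ} (ht : t ∈ Icc 0 T) :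
    dt T (u - v) t = dt T u t - dt T v t :=
  derivWithin_sub (hu t ht) (hv t ht)

theorem TwiceDiff.sub (hu : TwiceDiff T u) (hv : TwiceDiff T v) :
    TwiceDiff T (u - v) :=
  ⟨hu.1.sub hv.1, (hu.2.sub hv.2).congr fun _ ht => dt_sub hu.1 hv.1 ht⟩

theorem dt_dt_sub (hu : TwiceDiff T u) (hv : TwiceDiff T v) {t : ℝ}
    (ht : t ∈ Icc 0 T) :
    dt T (dt T (u - v)) t = dt T (dt T u) t - dt T (dt T v) t := by
  rw [← dt_sub hu.2 hv.2 ht]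
  exact derivWithin_congr (fun _ hs => dt_sub hu.1 hv.1 hs) (dt_sub hu.1 hv.1 ht)

theorem le_timeMax {g : ℝ → ℝ} (hg : ContinuousOn g (Icc 0 T)) {t : ℝ} (ht : t ∈ Icc 0 T) :
    g t ≤ timeMax T g :=
  (isGreatest_timeMax (ht.1.trans ht.2) hg).2 ⟨t, ht, rfl⟩

theorem timeMax_le {g : ℝ → ℝ} (hT : 0 ≤ T) {b : ℝ} (h : ∀ t ∈ Icc 0 T, g t ≤ b) :
    timeMax T g ≤ b :=
  csSup_le ((nonempty_Icc.2 hT).image g) (by rintro _ ⟨t, ht, rfl⟩; exact h t ht)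

end Time

/-! ### The error equation and the bound for `ξ`. -/

namespace Mesh

variable {ι κ : Type} [Fintype ι] {M : Mesh ι κ} {a : κ → ℝ × ℝ → ℝ} {a₀ a₁ : ℝ}

/-- The squared norms compare with factor `a₁`, and `a₁ ≤ (1 + a₁) ^ 2` avoids a square root in the
constant. -/
theorem IsCoeff.aNorm_le_mul_h1Norm [Nonempty ι] (ha : M.IsCoeff a a₀ a₁) (h₀ : 0 ≤ a₀)
    (h₁ : a₀ ≤ a₁) {γ : ℝ} (hγ : 0 ≤ γ) (u : PW ι) :
    M.aNorm a γ u ≤ (1 + a₁) * M.h1Norm γ u := by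
  have ha₁ := h₀.trans h₁
  have hH := isCoeff_one.aInner_self_nonneg (M := M) zero_le_one hγ u
  rw [aNorm_eq, h1Norm_eq]
  refine Real.sqrt_le_iff.2 ⟨by positivity, (ha.aInner_self_le h₀ hγ u).trans ?_⟩
  rw [mul_pow, Real.sq_sqrt hH]
  exact mul_le_mul_of_nonneg_right (by nlinarith) hH

/-- The equation for `ξ = u_H - w_H`, with `η = u_h - w_H` on the right hand side. -/
theorem error_equation (ha : M.IsCoeff a a₀ a₁) (h₀ : 0 ≤ a₀) {γ T : ℝ}
    {f : ℝ → ℝ × ℝ → ℝ} {VH : Submodule ℝ (PW ι)} {uh uH wH : ℝ → PW ι} (huh : TwiceDiff T uh)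
    (huH : M.IsCoarseSolution a γ f T VH uH) (hwH : M.IsEllipticProjection a γ f T VH uh wH)
    (hw : TwiceDiff T wH) {t : ℝ} (ht : t ∈ Icc 0 T) {v : PW ι} (hv : v ∈ VH) :
    M.l2 (dt T (dt T (uH - wH)) t) v + M.aDG a γ ((uH - wH) t) v =
      M.l2 (dt T (dt T (uh - wH)) t) v := by
  have hsub : ∀ {B : PW ι → PW ι → ℝ}, IsBilinearMap ℝ B → ∀ x y z, B (x - y) z = B x z - B y z :=
    fun hB x y z => hB.toLinearMap.map_sub₂ x y z
  have h1 := (huH.2 t ht).2 v hv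
  have h2 := (hwH t ht).2 v hv
  -- Now `a_DG(u_h, v)` cancels, leaving `a_DG(w_H, v) = (f, v) - ((u_h)_tt, v)`; the load cancels
  -- on subtraction.
  rw [residual] at h2
  rw [dt_dt_sub huH.1 hw ht, dt_dt_sub huh hw ht, Pi.sub_apply,
    hsub isBilinearMap_l2, hsub isBilinearMap_l2, hsub (ha.isBilinearMap_aDG h₀ γ)]
  linarith

/-- The bound for `ξ` in the energy norms. -/
theorem discrete_error_le [Nonempty ι] {σ γ : ℝ} (hM : M.QuasiUniform σ) (hσ : 1 ≤ σ)
    (ha : M.IsCoeff a a₀ a₁) (h₀ : 0 < a₀) (h₁ : a₀ ≤ a₁) (hγ : 8 * a₁ ^ 2 * σ / a₀ ^ 2 ≤ γ)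
    {T : ℝ} {ξ g : ℝ → PW ι} (hξ : TwiceDiff T ξ)
    (hg : IntervalIntegrable (fun t => M.l2Norm (g t)) volume 0 T)
    (heq : ∀ t ∈ Icc 0 T, M.l2 (dt T (dt T ξ) t) (dt T ξ t) + M.aDG a γ (ξ t) (dt T ξ t) =
      M.l2 (g t) (dt T ξ t)) {t : ℝ} (ht : t ∈ Icc 0 T) :
    M.l2Norm (dt T ξ t) ≤
      M.l2Norm (dt T ξ 0) + 2 * M.aNorm a γ (ξ 0) + (∫ s in (0 : ℝ)..T, M.l2Norm (g s)) ∧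
    M.aNorm a γ (ξ t) ≤
      2 * (M.l2Norm (dt T ξ 0) + 2 * M.aNorm a γ (ξ 0) + ∫ s in (0 : ℝ)..T, M.l2Norm (g s)) := by
  have hγ0 : 0 ≤ γ := le_trans (by positivity) hγ
  have hA0 := ha.aInner_self_nonneg (M := M) h₀.le hγ0
  have hcoer := ha.aDG_self_mem hM hσ h₀ h₁ hγ
  have hD0 : ∀ u, 0 ≤ M.aDG a γ u u := fun u => by linarith [hA0 u, (hcoer u).1]
  have h : √(M.l2 (dt T ξ t) (dt T ξ t) + M.aDG a γ (ξ t) (ξ t)) ≤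
      √(M.l2 (dt T ξ 0) (dt T ξ 0) + M.aDG a γ (ξ 0) (ξ 0)) +
        ∫ s in (0 : ℝ)..T, √(M.l2 (g s) (g s)) :=
    sqrt_energy_le isBilinearMap_l2 l2_comm l2_self_nonneg (ha.isBilinearMap_aDG h₀.le γ)
    (aDG_comm γ) hD0 (fun t ht => (hξ.1 t ht).hasDerivWithinAt)
    (fun t ht => (hξ.2 t ht).hasDerivWithinAt) hg heq ht
  simp only [l2Norm_eq, aNorm_eq]
  -- The factor 2 is a crude substitute for `√2`.
  have key : ∀ x y : ℝ, 0 ≤ y → x ≤ 2 * y → √x ≤ 2 * √y := fun x y hy hxy =>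
    Real.sqrt_le_iff.2 ⟨by positivity, by rw [mul_pow, Real.sq_sqrt hy]; linarith⟩
  have h1 : √(M.l2 (dt T ξ t) (dt T ξ t)) ≤
      √(M.l2 (dt T ξ t) (dt T ξ t) + M.aDG a γ (ξ t) (ξ t)) :=
    Real.sqrt_le_sqrt (by linarith [hD0 (ξ t)])
  have h2 : √(M.aInner a γ (ξ t) (ξ t)) ≤
      2 * √(M.l2 (dt T ξ t) (dt T ξ t) + M.aDG a γ (ξ t) (ξ t)) := by
    have hl := l2_self_nonneg (M := M) (dt T ξ t)
    exact key _ _ (add_nonneg hl (hD0 _)) (by linarith [(hcoer (ξ t)).1])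
  have h3 := sqrt_add_le_sqrt_add_sqrt (l2_self_nonneg (M := M) (dt T ξ 0)) (hD0 (ξ 0))
  have h4 := key _ _ (hA0 (ξ 0)) (hcoer (ξ 0)).2
  constructor <;> linarith

end Mesh

end WaveDG

end

/-! ### Assembly of the final estimate. -/

theorem mainTheorem2 (a₀ a₁ : ℝ) (ha₀ : 0 < a₀) (ha₁ : a₀ ≤ a₁) :
    ∃ C : ℝ, 0 < C ∧ ∀ σ : ℝ, 1 ≤ σ → ∃ γ₀ : ℝ, 0 < γ₀ ∧
      ∀ (ι κ : Type) [Fintype ι] [Nonempty ι] (M : WaveDG.Mesh ι κ), M.QuasiUniform σ →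
      ∀ a : κ → ℝ × ℝ → ℝ, (∀ k, Measurable (a k)) →
        (∀ i, ∀ p ∈ M.cell i, a₀ ≤ a (M.blk i) p ∧ a (M.blk i) p ≤ a₁) →
      ∀ γ : ℝ, γ₀ ≤ γ →
      ∀ VH : Submodule ℝ (WaveDG.PW ι), VH ≤ M.brokenSpace →
      ∀ T : ℝ, 0 < T →
      ∀ f : ℝ → ℝ × ℝ → ℝ,
        (∀ t ∈ Set.Icc 0 T, MeasureTheory.MemLp (f t) 2
          (MeasureTheory.volume.restrict M.closedDomain)) →
      ∀ uh uH wH : ℝ → WaveDG.PW ι,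
        M.IsFineSolution a f T uh →
        M.IsCoarseSolution a γ f T VH uH →
        M.IsEllipticProjection a γ f T VH uh wH →
        WaveDG.TwiceDiff T wH →
      ∀ η ξ ε : ℝ → WaveDG.PW ι, η = uh - wH → ξ = uH - wH → ε = uh - uH →
        IntervalIntegrable (fun t => M.l2Norm (WaveDG.dt T (WaveDG.dt T η) t))
          MeasureTheory.volume 0 T →
        WaveDG.timeMax T (fun t => M.l2Norm (WaveDG.dt T ε t))
            + WaveDG.timeMax T (fun t => M.aNorm a γ (ε t))
          ≤ C * (WaveDG.timeMax T (fun t => M.l2Norm (WaveDG.dt T η t))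
            + WaveDG.timeMax T (fun t => M.h1Norm γ (η t))
            + (∫ t in (0 : ℝ)..T, M.l2Norm (WaveDG.dt T (WaveDG.dt T η) t))
            + (M.l2Norm (WaveDG.dt T ξ 0) + M.h1Norm γ (ξ 0))) := by
  have ha₁0 : 0 < a₁ := ha₀.trans_le ha₁
  -- The worst term is `ξ(0)`: the two bounds for `ξ` contribute `1 + 2` copies of `2 * aNorm`, and
  -- passing to the `H¹` norm costs `1 + a₁`.
  refine ⟨6 * (1 + a₁), by positivity, fun σ hσ => ⟨8 * a₁ ^ 2 * σ / a₀ ^ 2, by positivity, ?_⟩⟩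
  intro ι κ _ _ M hM a hmeas hbd γ hγ VH _ T hT f _ uh uH wH huh huH hwH hw η ξ ε hη hξ hε hint
  have ha : M.IsCoeff a a₀ a₁ := ⟨hmeas, fun i p hp => (hbd i p hp).1, fun i p hp => (hbd i p hp).2⟩
  have hγ0 : 0 ≤ γ := le_trans (by positivity) hγ
  have hηd : WaveDG.TwiceDiff T η := hη ▸ huh.1.sub hw
  have hξd : WaveDG.TwiceDiff T ξ := hξ ▸ huH.1.sub hw
  have hεd : ε = η - ξ := by rw [hε, hη, hξ]; abel
  have hξV : ∀ t, WaveDG.dt T ξ t ∈ VH := WaveDG.derivWithin_mem_submodule VH fun t ht => by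
    rw [hξ]; exact VH.sub_mem (huH.2 t ht).1 (hwH t ht).1
  have hξle := fun t (ht : t ∈ Set.Icc 0 T) =>
    WaveDG.Mesh.discrete_error_le hM hσ ha ha₀ ha₁ hγ hξd hint (fun t ht => by
      rw [hη, hξ]
      exact WaveDG.Mesh.error_equation ha ha₀.le huh.1 huH hwH hw ht (hξ ▸ hξV t)) ht
  have hη1 := fun t (ht : t ∈ Set.Icc 0 T) =>
    WaveDG.le_timeMax (g := fun t => M.l2Norm (WaveDG.dt T η t))
      (WaveDG.continuousOn_sqrt_bilin_self WaveDG.Mesh.isBilinearMap_l2 hηd.2.continuousOn) ht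
  have hη2 := fun t (ht : t ∈ Set.Icc 0 T) =>
    WaveDG.le_timeMax (g := fun t => M.h1Norm γ (η t)) (by
      simp only [WaveDG.Mesh.h1Norm_eq]
      exact WaveDG.continuousOn_sqrt_bilin_self
        (WaveDG.Mesh.isCoeff_one.isBilinearMap_aInner zero_le_one γ) hηd.1.continuousOn) ht
  set A := WaveDG.timeMax T (fun t => M.l2Norm (WaveDG.dt T η t))
  set H := WaveDG.timeMax T (fun t => M.h1Norm γ (η t))
  set I := ∫ t in (0 : ℝ)..T, M.l2Norm (WaveDG.dt T (WaveDG.dt T η) t)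
  have h0 : (0 : ℝ) ∈ Set.Icc 0 T := ⟨le_rfl, hT.le⟩
  have hA0 : 0 ≤ A := (Real.sqrt_nonneg _).trans (hη1 0 h0)
  have hH0 : 0 ≤ H := (Real.sqrt_nonneg _).trans (hη2 0 h0)
  have hI0 : 0 ≤ I := intervalIntegral.integral_nonneg hT.le fun _ _ => Real.sqrt_nonneg _
  have hl0 : 0 ≤ M.l2Norm (WaveDG.dt T ξ 0) := Real.sqrt_nonneg _
  have hh0 : 0 ≤ M.h1Norm γ (ξ 0) := Real.sqrt_nonneg _
  have hcmp := ha.aNorm_le_mul_h1Norm (M := M) ha₀.le ha₁ hγ0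
  have hE1 : WaveDG.timeMax T (fun t => M.l2Norm (WaveDG.dt T ε t)) ≤
      A + (M.l2Norm (WaveDG.dt T ξ 0) + 2 * M.aNorm a γ (ξ 0) + I) :=
    WaveDG.timeMax_le hT.le fun t ht => by
      rw [hεd, WaveDG.dt_sub hηd.1 hξd.1 ht]
      exact (WaveDG.sqrt_bilin_sub_le WaveDG.Mesh.isBilinearMap_l2 WaveDG.Mesh.l2_comm
        WaveDG.Mesh.l2_self_nonneg _ _).trans (add_le_add (hη1 t ht) (hξle t ht).1)
  have hE2 : WaveDG.timeMax T (fun t => M.aNorm a γ (ε t)) ≤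
      (1 + a₁) * H + 2 * (M.l2Norm (WaveDG.dt T ξ 0) + 2 * M.aNorm a γ (ξ 0) + I) :=
    WaveDG.timeMax_le hT.le fun t ht => by
      have h1 : M.aNorm a γ (ε t) ≤ M.aNorm a γ (η t) + M.aNorm a γ (ξ t) := by
        simp only [WaveDG.Mesh.aNorm_eq, hεd, Pi.sub_apply η ξ]
        exact WaveDG.sqrt_bilin_sub_le (ha.isBilinearMap_aInner ha₀.le γ)
          (WaveDG.Mesh.aInner_comm γ) (ha.aInner_self_nonneg ha₀.le hγ0) _ _
      have h2 := (hcmp (η t)).trans (mul_le_mul_of_nonneg_left (hη2 t ht) (by positivity))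
      linarith [(hξle t ht).2]
  have h3 := hcmp (ξ 0)
  -- These products let linear arithmetic enlarge every smaller coefficient to `6 * (1 + a₁)`.
  have hA := mul_nonneg ha₁0.le hA0
  have hH := mul_nonneg ha₁0.le hH0
  have hI := mul_nonneg ha₁0.le hI0
  have hl := mul_nonneg ha₁0.le hl0
  linarith
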